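/- **Conventions.** $\{x\}=x-\lfloor x\rfloor$ is the fractional part; complex powers use the principal branch of the logarithm; $\mathbb N_0=\{0,1,2,\dots\}$; for $\Re s>1$ and $x>0$, $\zeta(s,x)=\sum_{k\ge0}(k+x)^{-s}$; and ${}_1F_2(\alpha;\beta,\gamma;z)=\sum_{n\ge0}\frac{(\alpha)_n}{(\beta)_n(\gamma)_n}\frac{z^n}{n!}$. For $a\in\mathbb R\setminus\{0\}$, $b\in\mathbb R$, $d>0$ put $$R_{a,b,d}(s)=s\Big(\int_1^{(1-\{b\})/a}-\int_1^d\Big)\lfloor ax+\{b\}\rfloor\,x^{-s-1}\,dx$$ (if $a<0$, the integrand vanishes between $(1-\{b\})/a$ and $0$, where it is read as $0$), and for $k\ge1$ and $s\in\mathbb C\setminus\mathbb N_0$ put $$\begin{aligned}F_{s,k}(a,b,d)={}&\frac{\sin(2\pi bk)}{d^s s k}\,{}_1F_2\!\left(-\tfrac s2;\tfrac12,1-\tfrac s2;-\pi^2a^2d^2k^2\right)\\&-\frac{2\pi a d^{1-s}\cos(2\pi bk)}{1-s}\,{}_1F_2\!\left(\tfrac{1-s}2;\tfrac32,1+\tfrac{1-s}2;-\pi^2a^2d^2k^2\right)\\&+k^{s-1}(2\pi)^s\Gamma(-s)\frac1{2i}\left((-ia)^se^{2\pi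 i bk}-(ia)^se^{-2\pi i bk}\right).\end{aligned}$$ **Theorem.** Let $a\in\mathbb R\setminus\{0\}$, $b\in\mathbb R$, $d>0$. 1. Each $F_{s,k}(a,b,d)$ extends to an entire function of $s$ (denoted in the same way), the series $\sum_{k\ge1}F_{s,k}(a,b,d)$ converges absolutely for every $s\in\mathbb C$, and its sum is an entire function of $s$. For $\Re s>1$ it satisfies $$\sum_{k=1}^\infty F_{s,k}(a,b,d)=\frac\pi s\begin{cases}a^s\zeta(s,1-\{b\})-\left(\frac{ads}{s-1}+\{b\}-\frac12\right)d^{-s}+R_{a,b,d}(s),&a>0,\\[2pt]-(-a)^s\zeta(s,1-\{-b\})+\left(\frac{ads}{1-s}+\{-b\}-\frac12\right)d^{-s}-R_{-a,-b,d}(s),&a<0,\end{cases}$$ so that the series gives the holomorphic continuation of the right-hand side to $\mathbb C$. 2. For all $C\ge c>0$ and $\epsilon>0$, the series $\sum_{k\ge1}d^sF_{s,k}(a,b,d)$ converges absolutely and uniformly in $b\in\mathbb R$, $c\le|a|\le C$, $c\le d\le C$, $\Re s>-\epsilon$, $|\Im s|<\epsilon$. For every $B\in\mathbb R$, the series $\sum_{k\ge1}F_{s,k}(a,b,d)$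 itself converges absolutely and uniformly on the part of this set where $d\ge1$ or $\Re s\le B$. 3. Let $s\ne0$. If $\Re s<1$ and $b\notin\mathbb Z$, or if $\Re s<0$ and $b\in\mathbb Z$, then (as a limit of partial sums) $$\begin{aligned}\sum_{k=1}^\infty\bigg(&\frac{2\pi a\cos(2\pi bk)}{1-s}\,{}_1F_2\!\left(\tfrac{1-s}2;\tfrac32,1+\tfrac{1-s}2;-\pi^2a^2k^2\right)-\frac{\sin(2\pi bk)}{sk}\,{}_1F_2\!\left(-\tfrac s2;\tfrac12,1-\tfrac s2;-\pi^2a^2k^2\right)\bigg)\\&=\frac\pi s\left(\frac{as}{s-1}+\{b\}-\frac12-R_{a,b,1}(s)\right).\end{aligned}$$ -/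

import Mathlib

noncomputable section

/-- The generalized hypergeometric function `₁F₂(α; β, γ; z)`, as the everywhere convergent series
`∑ (α)ₙ / ((β)ₙ (γ)ₙ) zⁿ / n!` for `β, γ ∉ {0, -1, -2, …}`. -/
def hyp1F2 (α β γ z : ℂ) : ℂ :=
  ∑' n : ℕ, (ascPochhammer ℂ n).eval α /
    ((ascPochhammer ℂ n).eval β * (ascPochhammer ℂ n).eval γ) * (z ^ n / (n.factorial : ℂ))

/-- The hypergeometric part of the `k`-th term (`k ≥ 1`), a meromorphic function of `s` which may
have poles only at `s = 0, 1, 2, …`. -/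
def hyperTerm (a b d : ℝ) (k : ℕ) (s : ℂ) : ℂ :=
  (Real.sin (2 * Real.pi * b * k) : ℂ) / ((d : ℂ) ^ s * s * k) *
      hyp1F2 (-s / 2) (1 / 2) (1 - s / 2)
        (-((Real.pi ^ 2 * a ^ 2 * d ^ 2 * (k : ℝ) ^ 2 : ℝ) : ℂ))
    - 2 * Real.pi * a * (d : ℂ) ^ (1 - s) * (Real.cos (2 * Real.pi * b * k) : ℂ) / (1 - s) *
      hyp1F2 ((1 - s) / 2) (3 / 2) (1 + (1 - s) / 2)
        (-((Real.pi ^ 2 * a ^ 2 * d ^ 2 * (k : ℝ) ^ 2 : ℝ) : ℂ))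

/-- The Gamma part of the `k`-th term (`k ≥ 1`), with principal powers; meromorphic in `s` with
possible poles only at `s = 0, 1, 2, …`. -/
def gammaTerm (a b : ℝ) (k : ℕ) (s : ℂ) : ℂ :=
  (k : ℂ) ^ (s - 1) * (2 * Real.pi : ℂ) ^ s * Complex.Gamma (-s) * (1 / (2 * Complex.I)) *
    ((-Complex.I * a) ^ s * Complex.exp (Complex.I * (2 * Real.pi * b * k))
      - (Complex.I * a) ^ s * Complex.exp (-(Complex.I * (2 * Real.pi * b * k))))

/-- `R_{a,b,d}(s) = s (∫_1^{(1-{b})/a} - ∫_1^d) ⌊a x + {b}⌋ x^{-s-1} dx`. For `a < 0` the integrand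
vanishes on the open interval from `(1-{b})/a` to `0`, so no branch of the power at a negative
base enters. -/
def floorRemainder (a b d : ℝ) (s : ℂ) : ℂ :=
  s * ((∫ x in (1 : ℝ)..((1 - Int.fract b) / a),
          (⌊a * x + Int.fract b⌋ : ℂ) * (x : ℂ) ^ (-s - 1))
      - ∫ x in (1 : ℝ)..d, (⌊a * x + Int.fract b⌋ : ℂ) * (x : ℂ) ^ (-s - 1))

/-- The left-hand side of the principal identity. For `Re s > 1` and `x ∈ (0, 1]`, Mathlib's
`hurwitzZeta x s` is the sum of `(k + x)^{-s}` over `k ≥ 0`. -/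
def zetaSide (a b d : ℝ) (s : ℂ) : ℂ :=
  Real.pi / s *
    (if 0 < a then
      (a : ℂ) ^ s * HurwitzZeta.hurwitzZeta ((1 - Int.fract b : ℝ) : UnitAddCircle) s
        - (a * d * s / (s - 1) + ((Int.fract b : ℝ) : ℂ) - 1 / 2) * (d : ℂ) ^ (-s)
        + floorRemainder a b d s
    else
      -((-a : ℂ) ^ s * HurwitzZeta.hurwitzZeta ((1 - Int.fract (-b) : ℝ) : UnitAddCircle) s)
        + (a * d * s / (1 - s) + ((Int.fract (-b) : ℝ) : ℂ) - 1 / 2) * (d : ℂ) ^ (-s)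
        - floorRemainder (-a) (-b) d s)

/-- The series `∑ f k` converges absolutely and uniformly on `S`: the series of absolute values
and the series itself converge, both of them uniformly on `S`. -/
def AbsUnifConvOn {X : Type*} (f : ℕ → X → ℂ) (S : Set X) : Prop :=
  (∀ x ∈ S, Summable fun k => ‖f k x‖) ∧
  TendstoUniformlyOn (fun N x => ∑ k ∈ Finset.range N, ‖f k x‖) (fun x => ∑' k, ‖f k x‖)
    Filter.atTop S ∧
  TendstoUniformlyOn (fun N x => ∑ k ∈ Finset.range N, f k x) (fun x => ∑' k, f k x)
    Filter.atTop S

/-- Parameters `(a, b, d, s)` with `|a|` and `d` in `[c, C]`, `b` arbitrary, and `s` in the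
half-strip `Re s > -ε`, `|Im s| < ε`. -/
def paramRegion (c C ε : ℝ) : Set (ℝ × ℝ × ℝ × ℂ) :=
  {p | (c ≤ |p.1| ∧ |p.1| ≤ C) ∧ (c ≤ p.2.2.1 ∧ p.2.2.1 ≤ C) ∧
    -ε < p.2.2.2.re ∧ |p.2.2.2.im| < ε}

end

/-!
For `0 < Re s`, the function `F_{s,k}(a,b,d)` is `k⁻¹ ∫_d^∞ sin(2πk(ax+b)) x^{-s-1} dx`, a
combination of the incomplete Gamma functions `Γ(-s, ±2πikad)`, which are entire in `s`; the
splitting `Γ(-s, z) = Γ(-s) - γ(-s, z)` produces its Gamma and hypergeometric parts. Integrating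
along the horizontal ray from `±2πikad`, on which `e^{-w}` decays, gains a second factor `k⁻¹`, so
the series converges like `∑ k⁻²`, locally uniformly in all parameters. Since the partial sums of
`∑ sin(2πky)/k` are uniformly bounded, for `Re s > 1` the sum may be taken under the integral; it
is `∫_d^∞ π (1/2 - {ax+b}) x^{-s-1} dx`, whose floor part is a Hurwitz zeta function, and `a < 0`
follows by `(a, b) ↦ (-a, -b)`.

At `d = 1` the hypergeometric part alone is, up to sign, the integral over `(0, 1)` of the same
sine minus its value at `x = 0`, plus a boundary term. Dominated convergence again allows
summation under the integral: for `Re s < 0` by boundedness, and for `Re s < 1` because near a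
non-integer `b` the partial sums of the sawtooth series are uniformly Lipschitz.
-/

section

open Real Set Filter Topology MeasureTheory

/-- The partial sum `∑_{k=1}^N sin(2πky)/k` of the Fourier series of the sawtooth function; the
summation index is `k - 1`. -/
noncomputable def sawSum (N : ℕ) (y : ℝ) : ℝ :=
  ∑ k ∈ Finset.range N, sin (2 * π * (k + 1) * y) / (k + 1)

/-- The sawtooth function `π (1/2 - {y})`, with the value `0` at the integers, where its Fourier
series vanishes. -/
noncomputable def saw (y : ℝ) : ℝ :=
  if Int.fract y = 0 then 0 else π * (1 / 2 - Int.fract y)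

lemma measurable_saw : Measurable saw :=
  Measurable.ite (measurable_fract (measurableSet_singleton 0)) measurable_const
    ((measurable_const.sub measurable_fract).const_mul _)

lemma continuous_sawSum (N : ℕ) : Continuous (sawSum N) := by
  unfold sawSum; fun_prop

lemma sawSum_add_int (N : ℕ) (y : ℝ) (m : ℤ) : sawSum N (y + m) = sawSum N y := by
  refine Finset.sum_congr rfl fun k _ => ?_
  have hperiod : 2 * π * (k + 1) * (y + m)
      = 2 * π * (k + 1) * y + (((k + 1) * m : ℤ) : ℝ) * (2 * π) := by
    push_cast; ring
  rw [hperiod, sin_add_int_mul_two_pi]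

lemma sawSum_fract (N : ℕ) (y : ℝ) : sawSum N (Int.fract y) = sawSum N y := by
  rw [← sawSum_add_int N (Int.fract y) ⌊y⌋, Int.fract_add_floor]

lemma sawSum_one_sub (N : ℕ) (y : ℝ) : sawSum N (1 - y) = -sawSum N y := by
  have hneg : sawSum N (-y) = -sawSum N y := by simp [sawSum, neg_div]
  rw [← hneg, ← sawSum_add_int N (-y) 1]
  congr 1
  push_cast
  ring

lemma sawSum_half (N : ℕ) : sawSum N (1 / 2) = 0 := by
  refine Finset.sum_eq_zero fun k _ => ?_
  have : 2 * π * ((k : ℝ) + 1) * (1 / 2) = ((k + 1 : ℕ) : ℝ) * π := by push_cast; ring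
  rw [this, sin_nat_mul_pi, zero_div]

lemma hasDerivAt_sawSum (N : ℕ) (y : ℝ) :
    HasDerivAt (sawSum N) (2 * π * ∑ k ∈ Finset.range N, cos (2 * π * (k + 1) * y)) y := by
  unfold sawSum
  rw [Finset.mul_sum]
  refine HasDerivAt.fun_sum fun k _ => ?_
  refine (((hasDerivAt_const_mul (2 * π * (k + 1))).sin).div_const ((k : ℝ) + 1)).congr_deriv ?_
  field_simp

lemma sin_mul_two_sum_cos (N : ℕ) (y : ℝ) :
    sin (π * y) * (2 * ∑ k ∈ Finset.range N, cos (2 * π * (k + 1) * y))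
      = sin ((2 * N + 1) * π * y) - sin (π * y) := by
  induction N with
  | zero => simp
  | succ n ih =>
    have hupper : (2 * ((n + 1 : ℕ) : ℝ) + 1) * π * y = 2 * π * (n + 1) * y + π * y := by
      push_cast; ring
    have hlower : (2 * (n : ℝ) + 1) * π * y = 2 * π * (n + 1) * y - π * y := by ring
    rw [Finset.sum_range_succ, mul_add, mul_add, ih, hupper, hlower, sin_add, sin_sub]
    ring

lemma hasDerivAt_sawSum_of_sin_ne_zero (N : ℕ) {y : ℝ} (hy : sin (π * y) ≠ 0) :
    HasDerivAt (sawSum N) (π * (sin ((2 * N + 1) * π * y) / sin (π * y) - 1)) y := by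
  refine (hasDerivAt_sawSum N y).congr_deriv ?_
  rw [div_sub_one hy, ← sin_mul_two_sum_cos, mul_div_cancel_left₀ _ hy]
  ring

lemma abs_integral_mul_sin_le {φ φ' : ℝ → ℝ} {a b M : ℝ} (hab : a ≤ b) (hM : 0 < M)
    (hφ : ∀ u ∈ uIcc a b, HasDerivAt φ (φ' u) u) (hφ' : ContinuousOn φ' (uIcc a b))
    (hanti : ∀ u ∈ uIcc a b, φ' u ≤ 0) (hb : 0 ≤ φ b) :
    |∫ u in a..b, φ u * sin (M * u)| ≤ 2 * φ a / M := by
  have hcos : ∀ u ∈ uIcc a b, HasDerivAt (fun u => -cos (M * u) / M) (sin (M * u)) u := by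
    intro u _
    refine (((hasDerivAt_const_mul M).cos.neg).div_const M).congr_deriv ?_
    field_simp
  have hcos_le (u : ℝ) : |-cos (M * u) / M| ≤ 1 / M := by
    rw [abs_div, abs_neg, abs_of_pos hM]
    gcongr
    exact abs_cos_le_one _
  have hInt : IntervalIntegrable φ' volume a b := hφ'.intervalIntegrable
  have hdrop : ∫ u in a..b, φ' u = φ b - φ a :=
    intervalIntegral.integral_eq_sub_of_hasDerivAt hφ hInt
  have hφa : 0 ≤ φ a := by
    have : 0 ≤ ∫ u in a..b, -φ' u := intervalIntegral.integral_nonneg hab fun u hu =>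
      neg_nonneg.2 (hanti u (uIcc_of_le hab ▸ hu))
    rw [intervalIntegral.integral_neg] at this
    linarith
  have hrest : |∫ u in a..b, φ' u * (-cos (M * u) / M)| ≤ (φ a - φ b) * (1 / M) := by
    rw [← neg_sub, ← hdrop, ← intervalIntegral.integral_neg, ← intervalIntegral.integral_mul_const,
      ← norm_eq_abs]
    refine intervalIntegral.norm_integral_le_of_norm_le hab
      (Eventually.of_forall fun u hu => ?_) (hInt.neg.mul_const _)
    have hu' : φ' u ≤ 0 := hanti u (uIcc_of_le hab ▸ Ioc_subset_Icc_self hu)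
    rw [norm_mul, norm_eq_abs, abs_of_nonpos hu']
    exact mul_le_mul_of_nonneg_left (hcos_le u) (neg_nonneg.2 hu')
  have hboundary (c : ℝ) (hc : 0 ≤ φ c) : |φ c * (-cos (M * c) / M)| ≤ φ c * (1 / M) := by
    rw [abs_mul, abs_of_nonneg hc]
    exact mul_le_mul_of_nonneg_left (hcos_le c) hc
  rw [intervalIntegral.integral_mul_deriv_eq_deriv_mul hφ hcos hInt
    (Continuous.intervalIntegrable (by fun_prop) _ _)]
  calc _ ≤ |φ b * (-cos (M * b) / M)| + |φ a * (-cos (M * a) / M)|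
        + |∫ u in a..b, φ' u * (-cos (M * u) / M)| :=
        (abs_sub _ _).trans (by gcongr; exact abs_sub _ _)
    _ ≤ φ b * (1 / M) + φ a * (1 / M) + (φ a - φ b) * (1 / M) :=
        add_le_add (add_le_add (hboundary b hb) (hboundary a hφa)) hrest
    _ = 2 * φ a / M := by ring

lemma two_mul_le_sin_pi_mul {y : ℝ} (h0 : 0 ≤ y) (h1 : y ≤ 1 / 2) : 2 * y ≤ sin (π * y) := by
  have h := mul_le_sin (x := π * y) (by positivity) (by nlinarith [pi_pos])
  rwa [← mul_assoc, div_mul_cancel₀ _ pi_ne_zero] at h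

lemma sawSum_sub_eq_neg_integral (N : ℕ) {y : ℝ} (h0 : 0 < y) (h1 : y ≤ 1 / 2) :
    sawSum N y - π * (1 / 2 - y)
      = -(π * ∫ u in y..(1 / 2), (sin (π * u))⁻¹ * sin ((2 * N + 1) * π * u)) := by
  have hsin : ∀ u ∈ uIcc y (1 / 2), sin (π * u) ≠ 0 := fun u hu => by
    rw [uIcc_of_le h1] at hu
    linarith [two_mul_le_sin_pi_mul (h0.le.trans hu.1) hu.2, hu.1]
  have hderiv : ∀ u ∈ uIcc y (1 / 2), HasDerivAt (fun u => sawSum N u + π * u)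
      (π * ((sin (π * u))⁻¹ * sin ((2 * N + 1) * π * u))) u := fun u hu => by
    refine ((hasDerivAt_sawSum_of_sin_ne_zero N (hsin u hu)).add
      (hasDerivAt_const_mul π)).congr_deriv ?_
    ring
  have hcont : ContinuousOn (fun u => π * ((sin (π * u))⁻¹ * sin ((2 * N + 1) * π * u)))
      (uIcc y (1 / 2)) :=
    continuousOn_const.mul (ContinuousOn.mul (.inv₀ (by fun_prop) hsin) (by fun_prop))
  rw [← intervalIntegral.integral_const_mul,
    intervalIntegral.integral_eq_sub_of_hasDerivAt hderiv hcont.intervalIntegrable, sawSum_half]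
  ring

lemma abs_sawSum_sub_le (N : ℕ) {y : ℝ} (h0 : 0 < y) (h1 : y ≤ 1 / 2) :
    |sawSum N y - π * (1 / 2 - y)| ≤ 1 / ((2 * N + 1) * y) := by
  have hmem : ∀ u ∈ uIcc y (1 / 2), y ≤ u ∧ u ≤ 1 / 2 := by
    rw [uIcc_of_le h1]
    exact fun u hu => hu
  have hsin : ∀ u ∈ uIcc y (1 / 2), 0 < sin (π * u) := fun u hu => by
    have := two_mul_le_sin_pi_mul (h0.le.trans (hmem u hu).1) (hmem u hu).2
    linarith [(hmem u hu).1]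
  have hcos : ∀ u ∈ uIcc y (1 / 2), 0 ≤ cos (π * u) := fun u hu =>
    cos_nonneg_of_mem_Icc ⟨by nlinarith [pi_pos, (hmem u hu).1], by nlinarith [pi_pos, hmem u hu]⟩
  have hosc : |∫ u in y..(1 / 2), (sin (π * u))⁻¹ * sin ((2 * N + 1) * π * u)|
      ≤ 2 * (sin (π * y))⁻¹ / ((2 * N + 1) * π) :=
    abs_integral_mul_sin_le (φ' := fun u => -(cos (π * u) * π) / sin (π * u) ^ 2) h1 (by positivity)
      (fun u hu => (hasDerivAt_const_mul π).sin.inv (hsin u hu).ne')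
      (.div (by fun_prop) (by fun_prop) fun u hu => (pow_pos (hsin u hu) 2).ne')
      (fun u hu => div_nonpos_of_nonpos_of_nonneg
        (neg_nonpos.2 (mul_nonneg (hcos u hu) pi_pos.le)) (sq_nonneg _))
      (inv_nonneg.2 (hsin _ right_mem_uIcc).le)
  rw [sawSum_sub_eq_neg_integral N h0 h1, abs_neg, abs_mul, abs_of_pos pi_pos]
  calc _ ≤ π * (2 * (2 * y)⁻¹ / ((2 * N + 1) * π)) := by
        gcongr
        refine hosc.trans ?_
        gcongr
        exact two_mul_le_sin_pi_mul h0.le h1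
    _ = 1 / ((2 * N + 1) * y) := by field_simp

lemma abs_sawSum_le_of_small (N : ℕ) (y : ℝ) : |sawSum N y| ≤ 2 * π * N * |y| := by
  have hterm : ∀ k ∈ Finset.range N, |sin (2 * π * (k + 1) * y) / (k + 1)| ≤ 2 * π * |y| := by
    intro k _
    have hk : (0 : ℝ) < k + 1 := by positivity
    rw [abs_div, abs_of_pos hk, div_le_iff₀ hk]
    refine abs_sin_le_abs.trans_eq ?_
    rw [abs_mul, abs_of_pos (by positivity)]
    ring
  calc |sawSum N y| ≤ N • (2 * π * |y|) := by
        simpa [sawSum] using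
          (Finset.abs_sum_le_sum_abs _ _).trans (Finset.sum_le_card_nsmul _ _ _ hterm)
    _ = 2 * π * N * |y| := by rw [nsmul_eq_mul]; ring

-- For `y ≤ 1/N` every term is small; for `y > 1/N` the partial sum is within `1` of its limit.
lemma abs_sawSum_le_of_mem_Icc (N : ℕ) {y : ℝ} (h0 : 0 ≤ y) (h1 : y ≤ 1 / 2) :
    |sawSum N y| ≤ 8 := by
  rcases le_or_gt (N * y) 1 with h | h
  · refine (abs_sawSum_le_of_small N y).trans ?_
    rw [abs_of_nonneg h0]
    nlinarith [pi_lt_d2, pi_pos]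
  · have hy : 0 < y := pos_of_mul_pos_right (one_pos.trans h) N.cast_nonneg
    have herror : 1 / ((2 * N + 1) * y) ≤ 1 := by
      rw [div_le_one (by positivity)]
      nlinarith
    have := abs_le.1 ((abs_sawSum_sub_le N hy h1).trans herror)
    rw [abs_le]
    constructor <;> nlinarith [pi_lt_d2, pi_pos]

lemma abs_sawSum_le (N : ℕ) (y : ℝ) : |sawSum N y| ≤ 8 := by
  rw [← sawSum_fract]
  have h0 := Int.fract_nonneg y
  have h1 := Int.fract_lt_one y
  rcases le_total (Int.fract y) (1 / 2) with h | h
  · exact abs_sawSum_le_of_mem_Icc N h0 h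
  · rw [← abs_neg, ← sawSum_one_sub]
    exact abs_sawSum_le_of_mem_Icc N (by linarith) (by linarith)

lemma tendsto_sawSum_of_mem_Ioc {y : ℝ} (h0 : 0 < y) (h1 : y ≤ 1 / 2) :
    Tendsto (fun N => sawSum N y) atTop (𝓝 (π * (1 / 2 - y))) := by
  rw [tendsto_iff_norm_sub_tendsto_zero]
  refine squeeze_zero (fun _ => norm_nonneg _) (fun N => abs_sawSum_sub_le N h0 h1) ?_
  have : Tendsto (fun N : ℕ => (2 * (N : ℝ) + 1) * y) atTop atTop :=
    (tendsto_atTop_add_const_right _ _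
      (tendsto_natCast_atTop_atTop.const_mul_atTop two_pos)).atTop_mul_const h0
  simpa only [one_div] using! this.inv_tendsto_atTop

lemma tendsto_sawSum (y : ℝ) : Tendsto (fun N => sawSum N y) atTop (𝓝 (saw y)) := by
  simp_rw [← sawSum_fract _ y]
  unfold saw
  split_ifs with h
  · simp [h, sawSum]
  · have h0 : 0 < Int.fract y := (Int.fract_nonneg y).lt_of_ne' h
    have h1 := Int.fract_lt_one y
    rcases le_total (Int.fract y) (1 / 2) with h' | h'
    · exact tendsto_sawSum_of_mem_Ioc h0 h'
    · have hrefl := (tendsto_sawSum_of_mem_Ioc (y := 1 - Int.fract y)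
        (by linarith) (by linarith)).neg
      simp_rw [sawSum_one_sub, neg_neg] at hrefl
      convert hrefl using 2
      ring

lemma exists_abs_sawSum_sub_le {b : ℝ} (hb : ∀ m : ℤ, b ≠ m) :
    ∃ C : ℝ, ∀ (N : ℕ) (x : ℝ), |sawSum N (b + x) - sawSum N b| ≤ C * |x| := by
  have hsin : sin (π * b) ≠ 0 := fun h => by
    obtain ⟨m, hm⟩ := sin_eq_zero_iff.1 h
    exact hb m (mul_left_cancel₀ pi_ne_zero (by linarith))
  obtain ⟨m, hm0, hm⟩ := exists_between (abs_pos.2 hsin)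
  obtain ⟨δ, hδ, hball⟩ := Metric.eventually_nhds_iff_ball.1
    ((by fun_prop : Continuous fun y => |sin (π * y)|).continuousAt.eventually_const_lt hm)
  have hnear : ∀ (N : ℕ), ∀ y ∈ Metric.ball b δ,
      ‖π * (sin ((2 * N + 1) * π * y) / sin (π * y) - 1)‖ ≤ π * (1 / m + 1) := by
    intro N y hy
    rw [norm_mul, norm_eq_abs, abs_of_pos pi_pos]
    gcongr
    refine (norm_sub_le _ _).trans ?_
    rw [norm_one, norm_div]
    gcongr
    · exact abs_sin_le_one _
    · exact (hball y hy).le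
  refine ⟨max (π * (1 / m + 1)) (16 / δ), fun N x => ?_⟩
  rcases lt_or_ge |x| δ with hx | hx
  · have hlip := (convex_ball b δ).norm_image_sub_le_of_norm_hasDerivWithin_le
      (fun y hy => (hasDerivAt_sawSum_of_sin_ne_zero N
        (abs_pos.1 (hm0.trans (hball y hy)))).hasDerivWithinAt)
      (hnear N) (Metric.mem_ball_self hδ) (y := b + x) (by simpa using hx)
    rw [norm_eq_abs, add_sub_cancel_left, norm_eq_abs] at hlip
    exact hlip.trans (by gcongr; exact le_max_left _ _)
  · calc |sawSum N (b + x) - sawSum N b| ≤ 8 + 8 :=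
          (abs_sub _ _).trans (add_le_add (abs_sawSum_le _ _) (abs_sawSum_le _ _))
      _ ≤ 16 / δ * |x| := by rw [div_mul_eq_mul_div, le_div_iff₀ hδ]; linarith
      _ ≤ _ := by gcongr; exact le_max_right _ _

lemma aestronglyMeasurable_deriv_of_eventually {α E : Type*} [MeasurableSpace α]
    {μ : Measure α} [NormedAddCommGroup E] [NormedSpace ℂ E] {F : ℂ → α → E} {z₀ : ℂ}
    (hmeas : ∀ᶠ z in 𝓝 z₀, AEStronglyMeasurable (F z) μ)
    (hdiff : ∀ᵐ x ∂μ, DifferentiableAt ℂ (F · x) z₀) :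
    AEStronglyMeasurable (fun x => deriv (F · x) z₀) μ := by
  obtain ⟨r, hr, hball⟩ := Metric.eventually_nhds_iff_ball.1 hmeas
  set u : ℕ → ℂ := fun n => z₀ + ((r / (n + 2) : ℝ) : ℂ) with hu
  have hu_tendsto : Tendsto u atTop (𝓝[≠] z₀) := by
    refine tendsto_nhdsWithin_iff.2 ⟨?_, Eventually.of_forall fun n => ?_⟩
    · have : Tendsto (fun n : ℕ => r / ((n : ℝ) + 2)) atTop (𝓝 0) :=
        tendsto_const_nhds.div_atTop (tendsto_atTop_add_const_right _ _ tendsto_natCast_atTop_atTop)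
      simpa only [Complex.ofReal_zero, add_zero] using!
        ((Complex.continuous_ofReal.tendsto 0).comp this).const_add z₀
    · have : r / ((n : ℝ) + 2) ≠ 0 := by positivity
      simpa only [hu, mem_compl_iff, mem_singleton_iff, add_eq_left, Complex.ofReal_eq_zero]
  have hu_mem (n : ℕ) : u n ∈ Metric.ball z₀ r := by
    have : r / ((n : ℝ) + 2) < r := div_lt_self hr (by linarith [n.cast_nonneg (α := ℝ)])
    rwa [Metric.mem_ball, hu, dist_self_add_left, Complex.norm_real,
      norm_of_nonneg (by positivity)]
  refine aestronglyMeasurable_of_tendsto_ae atTop (f := fun n x => slope (F · x) z₀ (u n))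
    (fun n => ?_) ?_
  · exact ((hball _ (hu_mem n)).sub (hball _ (Metric.mem_ball_self hr))).const_smul _
  · filter_upwards [hdiff] with x hx using hx.hasDerivAt.tendsto_slope.comp hu_tendsto

lemma hasDerivAt_integral_of_dominated_of_differentiableOn {α E : Type*} [MeasurableSpace α]
    {μ : Measure α} [NormedAddCommGroup E] [NormedSpace ℂ E] {F : ℂ → α → E} {g : α → ℝ} {z₀ : ℂ}
    {r : ℝ} (hr : 0 < r) (hmeas : ∀ z ∈ Metric.ball z₀ r, AEStronglyMeasurable (F z) μ)
    (hdiff : ∀ᵐ x ∂μ, DifferentiableOn ℂ (F · x) (Metric.ball z₀ r))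
    (hle : ∀ᵐ x ∂μ, ∀ z ∈ Metric.ball z₀ r, ‖F z x‖ ≤ g x) (hg : Integrable g μ) :
    HasDerivAt (fun z => ∫ x, F z x ∂μ) (∫ x, deriv (F · x) z₀ ∂μ) z₀ := by
  have hz₀ : z₀ ∈ Metric.ball z₀ r := Metric.mem_ball_self hr
  have hball : Metric.ball z₀ (r / 2) ⊆ Metric.ball z₀ r := Metric.ball_subset_ball (by linarith)
  have hmeas' := eventually_of_mem (Metric.ball_mem_nhds z₀ hr) hmeas
  refine (hasDerivAt_integral_of_dominated_loc_of_deriv_le (F' := fun z x => deriv (F · x) z)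
    (bound := fun x => g x / (r / 2)) (Metric.ball_mem_nhds z₀ (half_pos hr)) hmeas' ?_
    (aestronglyMeasurable_deriv_of_eventually hmeas'
      (hdiff.mono fun x hx => hx.differentiableAt (Metric.ball_mem_nhds z₀ hr)))
    ?_ (hg.div_const _) ?_).2
  · exact hg.mono' (hmeas _ hz₀) (hle.mono fun x hx => hx _ hz₀)
  · filter_upwards [hle, hdiff] with x hx hd z hz
    have hsub : Metric.closedBall z (r / 2) ⊆ Metric.ball z₀ r := fun w hw =>
      (dist_triangle w z z₀).trans_lt
        (by linarith [Metric.mem_ball.1 hz, Metric.mem_closedBall.1 hw])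
    exact Complex.norm_deriv_le_of_forall_mem_sphere_norm_le (half_pos hr)
      ((hd.mono hsub).diffContOnCl_ball subset_rfl)
      fun w hw => hx w (hsub (Metric.sphere_subset_closedBall hw))
  · filter_upwards [hdiff] with x hx z hz
    exact (hx.differentiableAt (Metric.isOpen_ball.mem_nhds (hball hz))).hasDerivAt

lemma norm_cpow_le_exp_mul (z w : ℂ) : ‖z ^ w‖ ≤ exp (π * |w.im|) * ‖z‖ ^ w.re := by
  refine (Complex.norm_cpow_le z w).trans ?_
  rw [div_eq_mul_inv, ← exp_neg, mul_comm]
  gcongr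
  calc -(Complex.arg z * w.im) ≤ |Complex.arg z * w.im| := neg_le_abs _
    _ ≤ π * |w.im| := by rw [abs_mul]; gcongr; exact Complex.abs_arg_le_pi z

lemma rpow_le_add_inv_rpow {x p P : ℝ} (hx : 0 < x) (hp : |p| ≤ P) : x ^ p ≤ (x + x⁻¹) ^ P := by
  have hone : 1 ≤ x + x⁻¹ := by
    rcases le_total 1 x with h | h
    · linarith [inv_pos.2 hx]
    · linarith [one_le_inv₀ hx |>.2 h]
  refine le_trans ?_ (rpow_le_rpow_of_exponent_le hone hp)
  rcases abs_cases p with ⟨h, h0⟩ | ⟨h, h0⟩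
  · rw [h]
    exact rpow_le_rpow hx.le (by linarith [inv_pos.2 hx]) h0
  · rw [h, ← inv_inv (x ^ p), ← rpow_neg hx.le, ← inv_rpow hx.le]
    exact rpow_le_rpow (inv_pos.2 hx).le (by linarith) (by linarith)

lemma exists_one_add_mul_rpow_le_exp {K : ℝ} (hK : 0 < K) (p : ℝ) :
    ∃ M : ℝ, 0 < M ∧ ∀ t : ℝ, 0 ≤ t → (1 + K * t) ^ p ≤ M * exp (t / 2) := by
  obtain ⟨n, hn⟩ := exists_nat_ge p
  refine ⟨n.factorial * (2 * K) ^ n * exp (1 / (2 * K)), by positivity, fun t ht => ?_⟩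
  have hone : 1 ≤ 1 + K * t := le_add_of_nonneg_right (by positivity)
  have hexp := pow_div_factorial_le_exp ((1 + K * t) / (2 * K)) (by positivity) n
  have hsplit : (1 + K * t) / (2 * K) = 1 / (2 * K) + t / 2 := by field_simp
  rw [div_le_iff₀ (by positivity), div_pow, div_le_iff₀ (by positivity)] at hexp
  calc (1 + K * t) ^ p ≤ (1 + K * t) ^ n := by
        rw [← rpow_natCast]; exact rpow_le_rpow_of_exponent_le hone hn
    _ ≤ exp ((1 + K * t) / (2 * K)) * n.factorial * (2 * K) ^ n := hexp
    _ = _ := by rw [hsplit, exp_add]; ring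

/-- The integrand `e^{-w} w^{s-1}` of Euler's integral, with the principal power. -/
noncomputable def gammaKernel (s w : ℂ) : ℂ :=
  Complex.exp (-w) * w ^ (s - 1)

lemma gammaKernel_add_one (s w : ℂ) : gammaKernel (s + 1) w = Complex.exp (-w) * w ^ s := by
  rw [gammaKernel, add_sub_cancel_right]

lemma hasDerivAt_gammaKernel (s : ℂ) {w : ℂ} (hw : w ∈ Complex.slitPlane) :
    HasDerivAt (gammaKernel s) ((s - 1) * gammaKernel (s - 1) w - gammaKernel s w) w := by
  refine ((hasDerivAt_neg w).cexp.mul ((hasDerivAt_id w).cpow_const (c := s - 1) hw)).congr_deriv ?_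
  simp only [gammaKernel, id]
  ring

lemma differentiable_gammaKernel_left {w : ℂ} (hw : w ≠ 0) :
    Differentiable ℂ fun s => gammaKernel s w := fun _ =>
  (((differentiableAt_id.sub_const 1).const_cpow (Or.inl hw)).const_mul _)

lemma norm_gammaKernel_le (s w : ℂ) :
    ‖gammaKernel s w‖ ≤ exp (π * |s.im|) * exp (-w.re) * ‖w‖ ^ (s.re - 1) := by
  rw [gammaKernel, norm_mul, Complex.norm_exp, Complex.neg_re]
  refine (mul_le_mul_of_nonneg_left (norm_cpow_le_exp_mul _ _) (exp_pos _).le).trans_eq ?_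
  simp only [Complex.sub_im, Complex.one_im, sub_zero, Complex.sub_re, Complex.one_re]
  ring

lemma add_ofReal_mem_slitPlane {z : ℂ} (hz : z ∈ Complex.slitPlane) {t : ℝ} (ht : 0 ≤ t) :
    z + t ∈ Complex.slitPlane := by
  rw [Complex.mem_slitPlane_iff] at hz ⊢
  simp only [Complex.add_re, Complex.ofReal_re, Complex.add_im, Complex.ofReal_im, add_zero]
  exact hz.imp_left fun h => by linarith

lemma le_norm_add_ofReal_of_ball_subset {z₀ z : ℂ} {r : ℝ}
    (hr : Metric.ball z₀ (2 * r) ⊆ Complex.slitPlane) (hz : z ∈ Metric.ball z₀ r) {t : ℝ}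
    (ht : 0 ≤ t) : r ≤ ‖z + t‖ := by
  by_contra! h
  have hmem : -(t : ℂ) ∈ Metric.ball z₀ (2 * r) := by
    rw [Metric.mem_ball, dist_eq_norm] at hz ⊢
    calc ‖-(t : ℂ) - z₀‖ = ‖z - z₀ - (z + t)‖ := by congr 1; ring
      _ ≤ ‖z - z₀‖ + ‖z + t‖ := norm_sub_le _ _
      _ < 2 * r := by linarith
  have := Complex.mem_slitPlane_iff.1 (hr hmem)
  simp only [Complex.neg_re, Complex.ofReal_re, Complex.neg_im, Complex.ofReal_im, neg_zero, ne_eq,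
    not_true_eq_false, or_false] at this
  linarith

lemma exists_norm_gammaKernel_add_le (A B : ℝ) {r : ℝ} (hr : 0 < r) :
    ∃ M : ℝ, ∀ s z : ℂ, ‖s‖ ≤ A → ‖z‖ ≤ B → ∀ t : ℝ, 0 ≤ t → r ≤ ‖z + t‖ →
      ‖gammaKernel s (z + t)‖ ≤ M * exp (-(1 / 2) * t) := by
  obtain ⟨M, _, hexp⟩ := exists_one_add_mul_rpow_le_exp one_pos (A + 1)
  refine ⟨exp (π * A) * exp B * ((|B| + 1 + r⁻¹) ^ (A + 1) * M), fun s z hs hz t ht hrt => ?_⟩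
  have him : |s.im| ≤ A := (Complex.abs_im_le_norm s).trans hs
  have hre : |(s - 1).re| ≤ A + 1 :=
    (Complex.abs_re_le_norm _).trans ((norm_sub_le _ _).trans (by simpa using hs))
  have hexponent : -(z + t).re ≤ B - t := by
    have := (abs_le.1 ((Complex.abs_re_le_norm z).trans hz)).1
    simp only [Complex.add_re, Complex.ofReal_re]
    linarith
  have hpos : 0 < ‖z + t‖ := hr.trans_le hrt
  have hbase : ‖z + t‖ + ‖z + t‖⁻¹ ≤ (|B| + 1 + r⁻¹) * (1 + 1 * t) := by
    have hnorm : ‖z + t‖ ≤ |B| + t :=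
      (norm_add_le _ _).trans (add_le_add (hz.trans (le_abs_self B)) (by simp [abs_of_nonneg ht]))
    have hinv : ‖z + t‖⁻¹ ≤ r⁻¹ := inv_anti₀ hr hrt
    nlinarith [mul_nonneg (abs_nonneg B) ht, mul_nonneg (inv_pos.2 hr).le ht]
  have hpow : ‖z + t‖ ^ (s.re - 1) ≤ (|B| + 1 + r⁻¹) ^ (A + 1) * (M * exp (t / 2)) := calc
    _ ≤ (‖z + t‖ + ‖z + t‖⁻¹) ^ (A + 1) := rpow_le_add_inv_rpow hpos (by simpa using hre)
    _ ≤ ((|B| + 1 + r⁻¹) * (1 + 1 * t)) ^ (A + 1) :=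
        rpow_le_rpow (by positivity) hbase ((abs_nonneg _).trans hre)
    _ ≤ _ := by
        rw [mul_rpow (by positivity) (by positivity)]
        gcongr
        exact hexp t ht
  calc _ ≤ exp (π * |s.im|) * exp (-(z + t).re) * ‖z + t‖ ^ (s.re - 1) := norm_gammaKernel_le _ _
    _ ≤ exp (π * A) * exp (B - t) * ((|B| + 1 + r⁻¹) ^ (A + 1) * (M * exp (t / 2))) := by gcongr
    _ = exp (π * A) * exp B * ((|B| + 1 + r⁻¹) ^ (A + 1) * M) * (exp (-t) * exp (t / 2)) := by
        rw [sub_eq_add_neg, exp_add]; ring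
    _ = _ := by rw [← exp_add (-t)]; congr 2; ring

lemma exists_norm_gammaKernel_add_le_of_mem_slitPlane (s₀ : ℂ) {z₀ : ℂ}
    (hz₀ : z₀ ∈ Complex.slitPlane) :
    ∃ r > 0, Metric.ball z₀ r ⊆ Complex.slitPlane ∧ ∃ M : ℝ, ∀ s ∈ Metric.ball s₀ 1,
      ∀ z ∈ Metric.ball z₀ r, ∀ t : ℝ, 0 ≤ t →
        ‖gammaKernel s (z + t)‖ ≤ M * exp (-(1 / 2) * t) := by
  obtain ⟨R, hR, hball⟩ := Metric.isOpen_iff.1 Complex.isOpen_slitPlane z₀ hz₀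
  have hdouble : Metric.ball z₀ (2 * (R / 2)) ⊆ Complex.slitPlane := by
    rwa [mul_div_cancel₀ _ two_ne_zero]
  obtain ⟨M, hM⟩ := exists_norm_gammaKernel_add_le (‖s₀‖ + 1) (‖z₀‖ + R / 2) (half_pos hR)
  refine ⟨R / 2, half_pos hR, (Metric.ball_subset_ball (by linarith)).trans hball, M,
    fun s hs z hz t ht => hM s z ?_ ?_ t ht (le_norm_add_ofReal_of_ball_subset hdouble hz ht)⟩
  · linarith [norm_le_norm_add_norm_sub' s s₀, mem_ball_iff_norm.1 hs]
  · linarith [norm_le_norm_add_norm_sub' z z₀, mem_ball_iff_norm.1 hz]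

/-- The upper incomplete Gamma function `Γ(s, z) = ∫_z^∞ e^{-w} w^{s-1} dw`, integrated along the
horizontal ray from `z`; it is meant for `z` off the non-positive real axis. -/
noncomputable def upperIncompleteGamma (s z : ℂ) : ℂ :=
  ∫ t in Ioi (0 : ℝ), gammaKernel s (z + t)

section slitPlane

variable {z : ℂ}

lemma continuousOn_gammaKernel_add (s : ℂ) (hz : z ∈ Complex.slitPlane) :
    ContinuousOn (fun t : ℝ => gammaKernel s (z + t)) (Ici 0) := fun t ht =>
  ((hasDerivAt_gammaKernel s (add_ofReal_mem_slitPlane hz ht)).continuousAt.comp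
    (f := fun t : ℝ => z + t) (by fun_prop)).continuousWithinAt

lemma aestronglyMeasurable_gammaKernel_add (s : ℂ) (hz : z ∈ Complex.slitPlane) :
    AEStronglyMeasurable (fun t : ℝ => gammaKernel s (z + t)) (volume.restrict (Ioi 0)) :=
  ((continuousOn_gammaKernel_add s hz).mono Ioi_subset_Ici_self).aestronglyMeasurable
    measurableSet_Ioi

lemma integrableOn_const_mul_exp_neg_half (M : ℝ) :
    IntegrableOn (fun t => M * exp (-(1 / 2) * t)) (Ioi 0) :=
  (exp_neg_integrableOn_Ioi 0 one_half_pos).const_mul M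

lemma integrableOn_gammaKernel_add (s : ℂ) (hz : z ∈ Complex.slitPlane) :
    IntegrableOn (fun t : ℝ => gammaKernel s (z + t)) (Ioi 0) := by
  obtain ⟨r, hr, -, M, hM⟩ := exists_norm_gammaKernel_add_le_of_mem_slitPlane s hz
  exact (integrableOn_const_mul_exp_neg_half M).mono' (aestronglyMeasurable_gammaKernel_add s hz)
    (ae_restrict_of_forall_mem measurableSet_Ioi fun t ht =>
      hM s (Metric.mem_ball_self one_pos) z (Metric.mem_ball_self hr) t (le_of_lt ht))

lemma tendsto_gammaKernel_add_atTop (s : ℂ) (hz : z ∈ Complex.slitPlane) :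
    Tendsto (fun t : ℝ => gammaKernel s (z + t)) atTop (𝓝 0) := by
  obtain ⟨r, hr, -, M, hM⟩ := exists_norm_gammaKernel_add_le_of_mem_slitPlane s hz
  refine squeeze_zero_norm' (a := fun t => M * exp (-(1 / 2) * t)) ?_ ?_
  · filter_upwards [eventually_ge_atTop 0] with t ht using
      hM s (Metric.mem_ball_self one_pos) z (Metric.mem_ball_self hr) t ht
  · rw [← mul_zero M]
    exact (tendsto_exp_atBot.comp (tendsto_id.const_mul_atTop_of_neg (by norm_num))).const_mul M

lemma integral_deriv_gammaKernel_add (s : ℂ) (hz : z ∈ Complex.slitPlane) :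
    ∫ t in Ioi (0 : ℝ), ((s - 1) * gammaKernel (s - 1) (z + t) - gammaKernel s (z + t))
      = -gammaKernel s z := by
  rw [integral_Ioi_of_hasDerivAt_of_tendsto' (f := fun t : ℝ => gammaKernel s (z + t)) ?_ ?_
    (tendsto_gammaKernel_add_atTop s hz)]
  · simp only [Complex.ofReal_zero, add_zero, zero_sub]
  · intro t ht
    exact (hasDerivAt_gammaKernel s (add_ofReal_mem_slitPlane hz ht)).comp_const_add z t
      |>.comp_ofReal
  · exact ((integrableOn_gammaKernel_add (s - 1) hz).const_mul _).sub
      (integrableOn_gammaKernel_add s hz)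

lemma upperIncompleteGamma_add_one (s : ℂ) (hz : z ∈ Complex.slitPlane) :
    upperIncompleteGamma (s + 1) z = s * upperIncompleteGamma s z + gammaKernel (s + 1) z := by
  have h := integral_deriv_gammaKernel_add (s + 1) hz
  rw [add_sub_cancel_right, integral_sub ((integrableOn_gammaKernel_add s hz).const_mul _)
    (integrableOn_gammaKernel_add (s + 1) hz), integral_const_mul] at h
  unfold upperIncompleteGamma
  linear_combination -h

lemma hasDerivAt_upperIncompleteGamma (s : ℂ) (hz : z ∈ Complex.slitPlane) :
    HasDerivAt (upperIncompleteGamma s) (-gammaKernel s z) z := by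
  obtain ⟨r, hr, hball, M, hM⟩ := exists_norm_gammaKernel_add_le_of_mem_slitPlane s hz
  have hderiv {w : ℂ} (hw : w ∈ Complex.slitPlane) {t : ℝ} (ht : t ∈ Ioi (0 : ℝ)) :
      HasDerivAt (fun w => gammaKernel s (w + t))
        ((s - 1) * gammaKernel (s - 1) (w + t) - gammaKernel s (w + t)) w :=
    (hasDerivAt_gammaKernel s (add_ofReal_mem_slitPlane hw (le_of_lt ht))).comp_add_const w t
  have h := hasDerivAt_integral_of_dominated_of_differentiableOn hr
    (fun w hw => aestronglyMeasurable_gammaKernel_add s (hball hw))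
    (ae_restrict_of_forall_mem measurableSet_Ioi fun t ht w hw =>
      (hderiv (hball hw) ht).differentiableAt.differentiableWithinAt)
    (ae_restrict_of_forall_mem measurableSet_Ioi fun t ht w hw =>
      hM s (Metric.mem_ball_self one_pos) w hw t (le_of_lt ht))
    (integrableOn_const_mul_exp_neg_half M)
  rwa [setIntegral_congr_fun measurableSet_Ioi fun t ht => (hderiv hz ht).deriv,
    integral_deriv_gammaKernel_add s hz] at h

lemma differentiable_upperIncompleteGamma_left (hz : z ∈ Complex.slitPlane) :
    Differentiable ℂ fun s => upperIncompleteGamma s z := by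
  intro s
  obtain ⟨r, hr, -, M, hM⟩ := exists_norm_gammaKernel_add_le_of_mem_slitPlane s hz
  exact (hasDerivAt_integral_of_dominated_of_differentiableOn one_pos
    (fun s _ => aestronglyMeasurable_gammaKernel_add s hz)
    (ae_restrict_of_forall_mem measurableSet_Ioi fun t ht =>
      (differentiable_gammaKernel_left (Complex.slitPlane_ne_zero
        (add_ofReal_mem_slitPlane hz (le_of_lt ht)))).differentiableOn)
    (ae_restrict_of_forall_mem measurableSet_Ioi fun t ht s hs =>
      hM s hs z (Metric.mem_ball_self hr) t (le_of_lt ht))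
    (integrableOn_const_mul_exp_neg_half M)).differentiableAt

end slitPlane

lemma norm_le_norm_add_ofReal {z : ℂ} (hz : 0 ≤ z.re) {t : ℝ} (ht : 0 ≤ t) : ‖z‖ ≤ ‖z + t‖ := by
  rw [← abs_of_nonneg (norm_nonneg z), ← abs_of_nonneg (norm_nonneg (z + t)), ← sq_le_sq,
    Complex.sq_norm, Complex.sq_norm, Complex.normSq_apply, Complex.normSq_apply]
  simp only [Complex.add_re, Complex.ofReal_re, Complex.add_im, Complex.ofReal_im, add_zero]
  nlinarith

lemma exists_norm_upperIncompleteGamma_le {c : ℝ} (hc : 0 < c) (σ : ℝ) :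
    ∃ M : ℝ, 0 ≤ M ∧ ∀ s z : ℂ, s.re ≤ σ → 0 ≤ z.re → c ≤ ‖z‖ → ‖upperIncompleteGamma s z‖
      ≤ M * (exp (π * |s.im|) * exp (-z.re) * ‖z‖ ^ (s.re - 1)) := by
  obtain ⟨M, hM, hexp⟩ := exists_one_add_mul_rpow_le_exp (inv_pos.2 hc) |σ|
  refine ⟨∫ t in Ioi (0 : ℝ), M * exp (-(1 / 2) * t), integral_nonneg fun t => by positivity,
    fun s z hs hre hz => ?_⟩
  have hz0 : 0 < ‖z‖ := hc.trans_le hz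
  rw [← integral_mul_const]
  refine norm_integral_le_of_norm_le ((integrableOn_const_mul_exp_neg_half M).mul_const _)
    (ae_restrict_of_forall_mem measurableSet_Ioi fun t ht => ?_)
  have ht0 : 0 ≤ t := le_of_lt ht
  have hratio_le : ‖z + t‖ / ‖z‖ ≤ 1 + c⁻¹ * t := by
    rw [div_le_iff₀ hz0]
    have hnorm : ‖z + t‖ ≤ ‖z‖ + t := (norm_add_le _ _).trans_eq (by simp [abs_of_nonneg ht0])
    have hscale : t ≤ c⁻¹ * t * ‖z‖ := by
      rw [mul_right_comm, inv_mul_eq_div]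
      exact le_mul_of_one_le_left ht0 ((one_le_div hc).2 hz)
    linarith
  have hratio : (‖z + t‖ / ‖z‖) ^ (s.re - 1) ≤ M * exp (t / 2) := calc
    _ ≤ (‖z + t‖ / ‖z‖) ^ |σ| := rpow_le_rpow_of_exponent_le
        ((one_le_div hz0).2 (norm_le_norm_add_ofReal hre ht0)) (by linarith [le_abs_self σ])
    _ ≤ (1 + c⁻¹ * t) ^ |σ| := by gcongr
    _ ≤ _ := hexp t ht0
  have hnorm : ‖z + t‖ ^ (s.re - 1) = ‖z‖ ^ (s.re - 1) * (‖z + t‖ / ‖z‖) ^ (s.re - 1) := by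
    rw [← mul_rpow hz0.le (by positivity), mul_div_cancel₀ _ hz0.ne']
  have hdecay : exp (-(z + t).re) * exp (t / 2) = exp (-(1 / 2) * t) * exp (-z.re) := by
    rw [← exp_add, ← exp_add, Complex.add_re, Complex.ofReal_re]
    congr 1
    ring
  calc _ ≤ exp (π * |s.im|) * exp (-(z + t).re) * ‖z + t‖ ^ (s.re - 1) := norm_gammaKernel_le _ _
    _ ≤ exp (π * |s.im|) * exp (-(z + t).re) * (‖z‖ ^ (s.re - 1) * (M * exp (t / 2))) := by
        rw [hnorm]; gcongr
    _ = _ := by linear_combination exp (π * |s.im|) * ‖z‖ ^ (s.re - 1) * M * hdecay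

lemma mem_slitPlane_of_re_nonneg {p : ℂ} (hre : 0 ≤ p.re) (hp : p ≠ 0) : p ∈ Complex.slitPlane := by
  rcases hre.lt_or_eq with h | h
  · exact Or.inl h
  · exact Or.inr fun him => hp (Complex.ext h.symm him)

lemma mul_ofReal_mem_slitPlane {p : ℂ} (hp : p ∈ Complex.slitPlane) {x : ℝ} (hx : 0 < x) :
    p * x ∈ Complex.slitPlane := by
  rw [Complex.mem_slitPlane_iff] at hp ⊢
  rw [Complex.re_mul_ofReal, Complex.im_mul_ofReal]
  exact hp.imp (mul_pos · hx) (mul_ne_zero · hx.ne')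

lemma mul_ofReal_cpow (z : ℂ) {x : ℝ} (hx : 0 < x) (w : ℂ) :
    (z * x) ^ w = z ^ w * (x : ℂ) ^ w := by
  rcases eq_or_ne z 0 with rfl | hz
  · rcases eq_or_ne w 0 with rfl | hw
    · simp only [Complex.cpow_zero, mul_one]
    · simp only [zero_mul, Complex.zero_cpow hw]
  · have hx' : (x : ℂ) ≠ 0 := Complex.ofReal_ne_zero.2 hx.ne'
    rw [Complex.cpow_def_of_ne_zero (mul_ne_zero hz hx'), Complex.cpow_def_of_ne_zero hz,
      Complex.cpow_def_of_ne_zero hx', Complex.log_mul_ofReal x hx z hz, Complex.ofReal_log hx.le,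
      ← Complex.exp_add, ← add_mul, add_comm]

section ray

variable {p : ℂ} {s : ℂ}

lemma cpow_mul_gammaKernel_mul_ofReal (hp : p ≠ 0) (s : ℂ) {x : ℝ} (hx : 0 < x) :
    p ^ s * (gammaKernel (-s) (p * x) * p) = Complex.exp (-(p * x)) * (x : ℂ) ^ (-s - 1) := by
  have hcancel : p ^ s * p ^ (-s - 1) * p = 1 := by
    rw [← Complex.cpow_add _ _ hp, add_sub_assoc', add_neg_cancel, zero_sub,
      Complex.cpow_neg_one, inv_mul_cancel₀ hp]
  rw [gammaKernel, mul_ofReal_cpow p hx]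
  linear_combination Complex.exp (-(p * x)) * (x : ℂ) ^ (-s - 1) * hcancel

lemma integrableOn_exp_neg_mul_cpow (hre : 0 ≤ p.re) (hs : 0 < s.re) {d : ℝ} (hd : 0 < d) :
    IntegrableOn (fun x : ℝ => Complex.exp (-(p * x)) * (x : ℂ) ^ (-s - 1)) (Ioi d) := by
  refine (integrableOn_Ioi_rpow_of_lt (show -s.re - 1 < -1 by linarith) hd).mono'
    (ContinuousOn.aestronglyMeasurable ?_ measurableSet_Ioi)
    (ae_restrict_of_forall_mem measurableSet_Ioi fun x hx => ?_)
  · exact ContinuousOn.mul (by fun_prop) (ContinuousOn.cpow_const (by fun_prop)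
      fun x hx => Or.inl (by simpa using hd.trans hx))
  · have hx0 : 0 < x := hd.trans hx
    rw [norm_mul, Complex.norm_exp, Complex.norm_cpow_eq_rpow_re_of_pos hx0]
    refine mul_le_of_le_one_left (by positivity) (exp_le_one_iff.2 ?_)
    rw [Complex.neg_re, Complex.re_mul_ofReal]
    exact neg_nonpos.2 (mul_nonneg hre hx0.le)

lemma tendsto_upperIncompleteGamma_mul_ofReal (hre : 0 ≤ p.re) (hp : p ≠ 0) (hs : s.re < 1) :
    Tendsto (fun x : ℝ => upperIncompleteGamma s (p * x)) atTop (𝓝 0) := by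
  obtain ⟨M, hM0, hM⟩ := exists_norm_upperIncompleteGamma_le (norm_pos_iff.2 hp) s.re
  have hdecay : Tendsto (fun x : ℝ => M * (exp (π * |s.im|) * 1 * (‖p‖ * x) ^ (-(1 - s.re))))
      atTop (𝓝 0) := by
    have := (tendsto_rpow_neg_atTop (sub_pos.2 hs)).comp
      (tendsto_id.const_mul_atTop (norm_pos_iff.2 hp))
    simpa using! (this.const_mul (exp (π * |s.im|) * 1)).const_mul M
  refine squeeze_zero_norm' ?_ hdecay
  filter_upwards [eventually_ge_atTop 1] with x hx
  have hx0 : 0 ≤ x := zero_le_one.trans hx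
  have hnorm : ‖p * x‖ = ‖p‖ * x := by rw [norm_mul, Complex.norm_real, norm_of_nonneg hx0]
  have hre' : 0 ≤ (p * x).re := by rw [Complex.re_mul_ofReal]; positivity
  refine (hM s (p * x) le_rfl hre' (hnorm ▸ le_mul_of_one_le_right (norm_nonneg p) hx)).trans ?_
  rw [hnorm, neg_sub]
  gcongr
  exact exp_le_one_iff.2 (neg_nonpos.2 hre')

lemma cpow_mul_upperIncompleteGamma_eq_integral (hre : 0 ≤ p.re) (hp : p ≠ 0) (hs : 0 < s.re)
    {d : ℝ} (hd : 0 < d) :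
    p ^ s * upperIncompleteGamma (-s) (p * d)
      = ∫ x in Ioi d, Complex.exp (-(p * x)) * (x : ℂ) ^ (-s - 1) := by
  have hderiv : ∀ x ∈ Ici d, HasDerivAt (fun x : ℝ => -(p ^ s * upperIncompleteGamma (-s) (p * x)))
      (Complex.exp (-(p * x)) * (x : ℂ) ^ (-s - 1)) x := by
    intro x hx
    have hx0 : 0 < x := hd.trans_le hx
    refine ((((hasDerivAt_upperIncompleteGamma (-s) (mul_ofReal_mem_slitPlane
      (mem_slitPlane_of_re_nonneg hre hp) hx0)).comp (x : ℂ) (hasDerivAt_const_mul p)).const_mul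
        (p ^ s)).neg.comp_ofReal).congr_deriv ?_
    rw [← cpow_mul_gammaKernel_mul_ofReal hp s hx0]
    ring
  have hlim := ((tendsto_upperIncompleteGamma_mul_ofReal (s := -s) hre hp
    (by rw [Complex.neg_re]; linarith)).const_mul (p ^ s)).neg
  rw [integral_Ioi_of_hasDerivAt_of_tendsto' hderiv (integrableOn_exp_neg_mul_cpow hre hs hd) hlim]
  ring

end ray

/-- The series `∑ xⁿ / (n! (n - s))`. At `x = -z`, its product with `z^{-s}` is the lower incomplete
Gamma function `γ(-s, z)`. -/
noncomputable def lowerGammaSeries (x s : ℂ) : ℂ :=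
  ∑' n : ℕ, x ^ n / (n.factorial * (n - s))

lemma summable_lowerGammaSeries (x s : ℂ) :
    Summable fun n : ℕ => x ^ n / (n.factorial * (n - s)) := by
  refine Summable.of_norm_bounded_eventually_nat (Real.summable_pow_div_factorial ‖x‖) ?_
  obtain ⟨m, hm⟩ := exists_nat_ge (‖s‖ + 1)
  filter_upwards [eventually_ge_atTop m] with n hn
  have hone : 1 ≤ ‖(n : ℂ) - s‖ := by
    have h := norm_sub_norm_le (n : ℂ) s
    rw [Complex.norm_natCast] at h
    have : (m : ℝ) ≤ n := by exact_mod_cast hn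
    linarith
  rw [norm_div, norm_pow, norm_mul, Complex.norm_natCast]
  gcongr
  exact le_mul_of_one_le_right (by positivity) hone

lemma differentiable_lowerGammaSeries_and_hasSum_deriv (x s : ℂ) :
    DifferentiableAt ℂ (lowerGammaSeries · s) x ∧
      HasSum (fun n : ℕ => n * x ^ (n - 1) / (n.factorial * (n - s)))
        (deriv (lowerGammaSeries · s) x) := by
  have hsummable := (summable_lowerGammaSeries ((‖x‖ + 1 : ℝ) : ℂ) s).norm
  have hle (n : ℕ) (w : ℂ) (hw : w ∈ Metric.ball 0 (‖x‖ + 1)) :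
      ‖w ^ n / (n.factorial * (n - s))‖
        ≤ ‖((‖x‖ + 1 : ℝ) : ℂ) ^ n / (n.factorial * (n - s))‖ := by
    rw [norm_div, norm_div, norm_pow, norm_pow, Complex.norm_real,
      norm_of_nonneg (by positivity)]
    gcongr
    exact (mem_ball_zero_iff.1 hw).le
  have hdiff (n : ℕ) : DifferentiableOn ℂ (fun w : ℂ => w ^ n / (n.factorial * (n - s)))
      (Metric.ball 0 (‖x‖ + 1)) := by fun_prop
  have hx : x ∈ Metric.ball 0 (‖x‖ + 1) := by simp
  refine ⟨(Complex.differentiableOn_tsum_of_summable_norm hsummable hdiff Metric.isOpen_ball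
    hle).differentiableAt (Metric.isOpen_ball.mem_nhds hx), ?_⟩
  refine (Complex.hasSum_deriv_of_summable_norm hsummable hdiff Metric.isOpen_ball hle
    hx).congr_fun fun n => ?_
  rw [deriv_div_const, deriv_pow_field]

lemma differentiable_lowerGammaSeries (s : ℂ) : Differentiable ℂ (lowerGammaSeries · s) :=
  fun x => (differentiable_lowerGammaSeries_and_hasSum_deriv x s).1

lemma lowerGammaSeries_zero_left (s : ℂ) : lowerGammaSeries 0 s = -s⁻¹ := by
  rw [lowerGammaSeries, tsum_eq_single 0 fun n hn => by rw [zero_pow hn, zero_div]]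
  simp [inv_neg]

section

variable {s : ℂ}

lemma hasSum_mul_lowerGammaSeries (hs : ∀ n : ℕ, s ≠ n) (x : ℂ) :
    HasSum (fun n : ℕ => n * (x ^ n / (n.factorial * (n - s))))
      (s * lowerGammaSeries x s + Complex.exp x) := by
  have hexp : HasSum (fun n : ℕ => x ^ n / (n.factorial : ℂ)) (Complex.exp x) := by
    rw [Complex.exp_eq_exp_ℂ]
    exact NormedSpace.expSeries_div_hasSum_exp x
  refine (((summable_lowerGammaSeries x s).hasSum.mul_left s).add hexp).congr_fun fun n => ?_
  have hn : (n : ℂ) - s ≠ 0 := sub_ne_zero.2 (hs n).symm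
  have hf : (n.factorial : ℂ) ≠ 0 := Nat.cast_ne_zero.2 n.factorial_ne_zero
  field_simp
  ring

lemma mul_deriv_lowerGammaSeries (hs : ∀ n : ℕ, s ≠ n) (x : ℂ) :
    x * deriv (lowerGammaSeries · s) x = s * lowerGammaSeries x s + Complex.exp x := by
  refine (((differentiable_lowerGammaSeries_and_hasSum_deriv x s).2.mul_left x).congr_fun
    fun n => ?_).unique (hasSum_mul_lowerGammaSeries hs x)
  rcases n with - | n
  · simp only [Nat.cast_zero, zero_mul, zero_div, mul_zero]
  · rw [Nat.add_sub_cancel, pow_succ]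
    ring

lemma lowerGammaSeries_add_one (hs : ∀ n : ℕ, s + 1 ≠ n) (x : ℂ) :
    (s + 1) * lowerGammaSeries x (s + 1) + Complex.exp x = x * lowerGammaSeries x s := by
  have hshift := (hasSum_nat_add_iff' 1).2 (hasSum_mul_lowerGammaSeries hs x)
  rw [Finset.sum_range_one, Nat.cast_zero, zero_mul, sub_zero] at hshift
  refine hshift.unique (((summable_lowerGammaSeries x s).hasSum.mul_left x).congr_fun fun n => ?_)
  have hf : (n.factorial : ℂ) ≠ 0 := Nat.cast_ne_zero.2 n.factorial_ne_zero
  have hn : (n : ℂ) + 1 ≠ 0 := Nat.cast_add_one_ne_zero n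
  rw [Nat.factorial_succ, Nat.cast_mul, Nat.cast_succ, add_sub_add_right_eq_sub]
  rcases eq_or_ne ((n : ℂ) - s) 0 with h | h
  · simp only [h, mul_zero, div_zero]
  · field_simp
    ring

lemma hasDerivAt_cpow_neg_mul_lowerGammaSeries (hs : ∀ n : ℕ, s ≠ n) (p : ℂ) {z : ℂ}
    (hz : z ∈ Complex.slitPlane) :
    HasDerivAt (fun z => z ^ (-s) * lowerGammaSeries (p * z) s)
      (Complex.exp (p * z) * z ^ (-s - 1)) z := by
  have hz0 := Complex.slitPlane_ne_zero hz
  have hseries := (differentiable_lowerGammaSeries s (p * z)).hasDerivAt.comp z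
    (hasDerivAt_const_mul p)
  refine (((hasDerivAt_id z).cpow_const (c := -s) hz).mul hseries).congr_deriv ?_
  have hode := mul_deriv_lowerGammaSeries hs (p * z)
  have hpow : z ^ (-s) = z ^ (-s - 1) * z := by
    rw [Complex.cpow_sub _ _ hz0, Complex.cpow_one, div_mul_cancel₀ _ hz0]
  simp only [id, Function.comp_apply, hpow]
  linear_combination z ^ (-s - 1) * hode

end

lemma ne_natCast_of_re_lt_one {s : ℂ} (hre : s.re < 1) (hs : s ≠ 0) (n : ℕ) : s ≠ n := by
  rintro rfl
  rw [Complex.natCast_re, Nat.cast_lt_one] at hre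
  exact hs (by rw [hre, Nat.cast_zero])

lemma sub_mul_cpow_eq_dslope_mul (f : ℂ → ℂ) {w : ℂ} (hw : w + 1 ≠ 0) (z : ℂ) :
    (f z - f 0) * z ^ w = dslope f 0 z * z ^ (w + 1) := by
  rcases eq_or_ne z 0 with rfl | hz
  · rw [sub_self, zero_mul, Complex.zero_cpow hw, mul_zero]
  · rw [← sub_smul_dslope, sub_zero, smul_eq_mul, Complex.cpow_add _ _ hz, Complex.cpow_one]
    ring

lemma continuous_dslope {f : ℂ → ℂ} (hf : Differentiable ℂ f) (z : ℂ) :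
    Continuous (dslope f z) :=
  continuousOn_univ.1 ((continuousOn_dslope univ_mem).2 ⟨hf.continuous.continuousOn, hf z⟩)

lemma intervalIntegrable_sub_mul_cpow {f : ℂ → ℂ} (hf : Differentiable ℂ f) {s : ℂ}
    (hre : s.re < 1) (hs : s ≠ 0) :
    IntervalIntegrable (fun x : ℝ => (f x - f 0) * (x : ℂ) ^ (-s - 1)) volume 0 1 := by
  have hne : -s - 1 + 1 ≠ 0 := by simpa using hs
  simp_rw [sub_mul_cpow_eq_dslope_mul f hne, sub_add_cancel]
  refine (intervalIntegral.intervalIntegrable_cpow' ?_).continuousOn_mul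
    ((continuous_dslope hf 0).comp Complex.continuous_ofReal).continuousOn
  rw [Complex.neg_re]
  linarith

lemma integral_exp_sub_one_mul_cpow (p : ℂ) {s : ℂ} (hre : s.re < 1) (hs : s ≠ 0) :
    ∫ x in (0 : ℝ)..1, (Complex.exp (p * x) - 1) * (x : ℂ) ^ (-s - 1)
      = lowerGammaSeries p s + s⁻¹ := by
  have hs1 : 0 < (-s + 1).re := by rw [Complex.add_re, Complex.neg_re, Complex.one_re]; linarith
  have hInt := intervalIntegrable_sub_mul_cpow (f := fun x => Complex.exp (p * x)) (by fun_prop)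
    hre hs
  have hcont : ContinuousOn
      (fun x : ℝ => (lowerGammaSeries (p * x) s - lowerGammaSeries (p * 0) s) * (x : ℂ) ^ (-s))
      (Icc 0 1) := by
    simp_rw [sub_mul_cpow_eq_dslope_mul (fun z => lowerGammaSeries (p * z) s)
      (fun h => hs1.ne' (by rw [h, Complex.zero_re]))]
    refine ContinuousOn.mul ((continuous_dslope ((differentiable_lowerGammaSeries s).comp
      (by fun_prop)) 0).comp Complex.continuous_ofReal).continuousOn fun x _ => ?_
    exact (Complex.continuousAt_ofReal_cpow_const x _ (Or.inl hs1)).continuousWithinAt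
  have hderiv : ∀ x ∈ Ioo (0 : ℝ) 1, HasDerivAt
      (fun x : ℝ => (lowerGammaSeries (p * x) s - lowerGammaSeries (p * 0) s) * (x : ℂ) ^ (-s))
      ((Complex.exp (p * x) - 1) * (x : ℂ) ^ (-s - 1)) x := by
    intro x hx
    have hx' : (x : ℂ) ∈ Complex.slitPlane := Complex.ofReal_mem_slitPlane.2 hx.1
    have hpow := ((hasDerivAt_id (x : ℂ)).cpow_const (c := -s) hx').const_mul
      (lowerGammaSeries (p * 0) s)
    refine (((hasDerivAt_cpow_neg_mul_lowerGammaSeries (ne_natCast_of_re_lt_one hre hs) p hx').sub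
      hpow).comp_ofReal.congr_of_eventuallyEq (Eventually.of_forall fun y => ?_)).congr_deriv ?_
    · simp only [id, Pi.sub_apply]
      ring
    · rw [mul_zero, lowerGammaSeries_zero_left]
      simp only [id]
      field_simp
  simp only [mul_zero, Complex.exp_zero] at hInt
  rw [intervalIntegral.integral_eq_sub_of_hasDerivAt_of_le zero_le_one hcont hderiv hInt]
  simp [lowerGammaSeries_zero_left]

lemma integral_exp_mul_cpow (p : ℂ) {s : ℂ} (hre : s.re < 0) :
    ∫ x in (0 : ℝ)..1, Complex.exp (p * x) * (x : ℂ) ^ (-s - 1) = lowerGammaSeries p s := by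
  have hs : s ≠ 0 := by
    rintro rfl
    exact hre.ne Complex.zero_re
  have hpow_re : -1 < (-s - 1).re := by
    rw [Complex.sub_re, Complex.neg_re, Complex.one_re]
    linarith
  have hpow := intervalIntegral.intervalIntegrable_cpow' (a := 0) (b := 1) hpow_re
  have hsplit : ∫ x in (0 : ℝ)..1, (Complex.exp (p * x) - 1) * (x : ℂ) ^ (-s - 1)
      = (∫ x in (0 : ℝ)..1, Complex.exp (p * x) * (x : ℂ) ^ (-s - 1))
        - ∫ x in (0 : ℝ)..1, (x : ℂ) ^ (-s - 1) := by
    rw [← intervalIntegral.integral_sub (hpow.continuousOn_mul (by fun_prop)) hpow]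
    simp_rw [sub_one_mul]
  rw [integral_exp_sub_one_mul_cpow p (by linarith) hs, integral_cpow (Or.inl hpow_re),
    sub_add_cancel, Complex.ofReal_zero, Complex.zero_cpow (neg_ne_zero.2 hs), Complex.ofReal_one,
    Complex.one_cpow, sub_zero, one_div, inv_neg, sub_neg_eq_add] at hsplit
  exact (add_right_cancel hsplit).symm

lemma upperIncompleteGamma_one_eq_integral (s : ℂ) :
    upperIncompleteGamma s 1 = ∫ x in Ioi (1 : ℝ), gammaKernel s x := by
  have h := (measurePreserving_add_left volume (1 : ℝ)).setIntegral_preimage_emb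
    (measurableEmbedding_addLeft 1) (fun x : ℝ => gammaKernel s x) (Ioi 1)
  rw [← h, preimage_const_add_Ioi, sub_self, upperIncompleteGamma]
  simp_rw [Complex.ofReal_add, Complex.ofReal_one]

lemma upperIncompleteGamma_one_add_lowerGammaSeries {s : ℂ} (hs : s.re < 0) :
    upperIncompleteGamma (-s) 1 + lowerGammaSeries (-1) s = Complex.Gamma (-s) := by
  have hre : 0 < (-s).re := by rwa [Complex.neg_re, neg_pos]
  have hInt := Complex.GammaIntegral_convergent hre
  rw [Complex.Gamma_eq_integral hre, Complex.GammaIntegral,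
    ← intervalIntegral.integral_interval_add_Ioi hInt (hInt.mono_set (Ioi_subset_Ioi zero_le_one)),
    ← integral_exp_mul_cpow (-1) hs, upperIncompleteGamma_one_eq_integral, add_comm]
  simp only [gammaKernel, Complex.ofReal_exp, Complex.ofReal_neg, neg_one_mul]

lemma isPreconnected_slitPlane : IsPreconnected Complex.slitPlane :=
  (Complex.starConvex_one_slitPlane.isPathConnected
    Complex.one_mem_slitPlane).isConnected.isPreconnected

lemma upperIncompleteGamma_add_lowerGammaSeries_eq_const {s z : ℂ} (hs : ∀ n : ℕ, s ≠ n)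
    (hz : z ∈ Complex.slitPlane) :
    upperIncompleteGamma (-s) z + z ^ (-s) * lowerGammaSeries (-z) s
      = upperIncompleteGamma (-s) 1 + lowerGammaSeries (-1) s := by
  have hderiv (w : ℂ) (hw : w ∈ Complex.slitPlane) : HasDerivAt
      (fun w => upperIncompleteGamma (-s) w + w ^ (-s) * lowerGammaSeries (-1 * w) s) 0 w := by
    refine ((hasDerivAt_upperIncompleteGamma (-s) hw).add
      (hasDerivAt_cpow_neg_mul_lowerGammaSeries hs (-1) hw)).congr_deriv ?_
    rw [gammaKernel, neg_one_mul, neg_add_cancel]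
  have := Complex.isOpen_slitPlane.is_const_of_deriv_eq_zero isPreconnected_slitPlane
    (fun w hw => (hderiv w hw).differentiableAt.differentiableWithinAt)
    (fun w hw => (hderiv w hw).deriv) hz Complex.one_mem_slitPlane
  simpa only [neg_one_mul, Complex.one_cpow, one_mul] using this

lemma upperIncompleteGamma_add_lowerGammaSeries {s z : ℂ} (hs : ∀ n : ℕ, s ≠ n)
    (hz : z ∈ Complex.slitPlane) :
    upperIncompleteGamma (-s) z + z ^ (-s) * lowerGammaSeries (-z) s = Complex.Gamma (-s) := by
  obtain ⟨m, hm⟩ := exists_nat_gt s.re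
  induction m generalizing s with
  | zero =>
    rw [upperIncompleteGamma_add_lowerGammaSeries_eq_const hs hz,
      upperIncompleteGamma_one_add_lowerGammaSeries (by exact_mod_cast hm)]
  | succ m ih =>
    obtain ⟨r, rfl⟩ : ∃ r, s = r + 1 := ⟨s - 1, by ring⟩
    have hz0 := Complex.slitPlane_ne_zero hz
    have hr0 : -(r + 1) ≠ 0 := neg_ne_zero.2 (by simpa using hs 0)
    have hneg : -r = -(r + 1) + 1 := by ring
    have hr := ih (s := r) (fun n h => hs (n + 1) (by rw [h, Nat.cast_succ]))
      (by simpa using hm)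
    rw [hneg, upperIncompleteGamma_add_one _ hz, Complex.Gamma_add_one _ hr0, gammaKernel_add_one,
      Complex.cpow_add _ _ hz0, Complex.cpow_one] at hr
    have hrec := lowerGammaSeries_add_one hs (-z)
    refine mul_left_cancel₀ hr0 ?_
    linear_combination hr - z ^ (-(r + 1)) * hrec

lemma ascPochhammer_eval_mul_add (α : ℂ) (n : ℕ) :
    (ascPochhammer ℂ n).eval α * (α + n) = α * (ascPochhammer ℂ n).eval (α + 1) := by
  rw [← ascPochhammer_succ_eval, ascPochhammer_succ_left, Polynomial.eval_mul, Polynomial.eval_X,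
    Polynomial.eval_comp, Polynomial.eval_add, Polynomial.eval_X, Polynomial.eval_one]

lemma ascPochhammer_eval_add_one_ne_zero {α : ℂ} (hα : ∀ n : ℕ, α + n ≠ 0) (n : ℕ) :
    (ascPochhammer ℂ n).eval (α + 1) ≠ 0 := by
  rw [Ne, ascPochhammer_eval_eq_zero_iff]
  rintro ⟨m, -, hm⟩
  refine hα (m + 1) ?_
  rw [Nat.cast_succ, hm]
  ring

lemma ascPochhammer_half (n : ℕ) :
    (ascPochhammer ℂ n).eval (1 / 2) * n.factorial * 4 ^ n = (2 * n).factorial := by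
  induction n with
  | zero => simp
  | succ n ih =>
    rw [ascPochhammer_succ_eval, mul_add_one, Nat.factorial_succ (2 * n + 1),
      Nat.factorial_succ (2 * n), Nat.factorial_succ n]
    push_cast
    rw [← ih]
    ring

lemma ascPochhammer_three_halves (n : ℕ) :
    (ascPochhammer ℂ n).eval (3 / 2) * n.factorial * 4 ^ n = (2 * n + 1).factorial := by
  induction n with
  | zero => simp
  | succ n ih =>
    rw [ascPochhammer_succ_eval, mul_add_one, Nat.factorial_succ (2 * n + 2),
      Nat.factorial_succ (2 * n + 1), Nat.factorial_succ n]
    push_cast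
    rw [← ih]
    ring

lemma hyp1F2_add_one_sq_div_four {α β : ℂ} {c : ℕ → ℕ} (hα : ∀ n : ℕ, α + n ≠ 0)
    (hc : ∀ n, c n ≠ 0) (hβ : ∀ n, (ascPochhammer ℂ n).eval β * n.factorial * 4 ^ n = c n)
    (x : ℂ) :
    hyp1F2 α β (α + 1) (x ^ 2 / 4) = α * ∑' n : ℕ, x ^ (2 * n) / (c n * (α + n)) := by
  rw [hyp1F2, ← tsum_mul_left]
  refine tsum_congr fun n => ?_
  have hα1 := ascPochhammer_eval_add_one_ne_zero hα n
  have hfactorial : (n.factorial : ℂ) ≠ 0 := Nat.cast_ne_zero.2 n.factorial_ne_zero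
  have hβ0 : (ascPochhammer ℂ n).eval β ≠ 0 := fun h0 => hc n (by
    rw [← Nat.cast_eq_zero (R := ℂ), ← hβ, h0, zero_mul, zero_mul])
  have hshift := ascPochhammer_eval_mul_add α n
  have hn := hα n
  rw [← hβ, div_pow, ← pow_mul]
  field_simp
  linear_combination x ^ (2 * n) * hshift

section

variable {s : ℂ}

lemma hyp1F2_even (hs : ∀ n : ℕ, s ≠ n) (x : ℂ) :
    hyp1F2 (-s / 2) (1 / 2) (1 - s / 2) (x ^ 2 / 4)
      = -s * ∑' n : ℕ, x ^ (2 * n) / ((2 * n).factorial * ((2 * n : ℕ) - s)) := by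
  have hne (n : ℕ) : -s / 2 + n ≠ 0 := fun h =>
    hs (2 * n) (by push_cast; linear_combination -2 * h)
  rw [show 1 - s / 2 = -s / 2 + 1 by ring, hyp1F2_add_one_sq_div_four hne
    (fun n => Nat.factorial_ne_zero _) ascPochhammer_half, div_mul_eq_mul_div, mul_div_assoc,
    ← tsum_div_const]
  congr 1
  refine tsum_congr fun n => ?_
  rw [div_div, mul_assoc]
  congr 2
  push_cast
  ring

lemma mul_hyp1F2_odd (hs : ∀ n : ℕ, s ≠ n) (x : ℂ) :
    x * hyp1F2 ((1 - s) / 2) (3 / 2) (1 + (1 - s) / 2) (x ^ 2 / 4)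
      = (1 - s) * ∑' n : ℕ,
        x ^ (2 * n + 1) / ((2 * n + 1).factorial * ((2 * n + 1 : ℕ) - s)) := by
  have hne (n : ℕ) : (1 - s) / 2 + n ≠ 0 := fun h =>
    hs (2 * n + 1) (by push_cast; linear_combination -2 * h)
  rw [add_comm 1, hyp1F2_add_one_sq_div_four hne (fun n => Nat.factorial_ne_zero _)
    ascPochhammer_three_halves, div_mul_eq_mul_div, mul_div_assoc, ← tsum_div_const,
    mul_left_comm, ← tsum_mul_left]
  congr 1
  refine tsum_congr fun n => ?_
  rw [div_div, ← mul_div_assoc, pow_succ', mul_assoc]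
  congr 2
  push_cast
  ring

lemma lowerGammaSeries_eq_even_add_odd (x s : ℂ) :
    lowerGammaSeries x s = ∑' n : ℕ, x ^ (2 * n) / ((2 * n).factorial * ((2 * n : ℕ) - s))
      + ∑' n : ℕ, x ^ (2 * n + 1) / ((2 * n + 1).factorial * ((2 * n + 1 : ℕ) - s)) := by
  have h := summable_lowerGammaSeries x s
  exact (tsum_even_add_odd (f := fun n : ℕ => x ^ n / ((n.factorial : ℂ) * (n - s)))
    (h.comp_injective (mul_right_injective₀ two_ne_zero))
    (h.comp_injective fun m n hmn => by simpa using hmn)).symm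

lemma lowerGammaSeries_eq_hyp1F2 (hs : ∀ n : ℕ, s ≠ n) (x : ℂ) :
    lowerGammaSeries x s
      = -(1 / s) * hyp1F2 (-s / 2) (1 / 2) (1 - s / 2) (x ^ 2 / 4)
        + x / (1 - s) * hyp1F2 ((1 - s) / 2) (3 / 2) (1 + (1 - s) / 2) (x ^ 2 / 4) := by
  have h0 : s ≠ 0 := by simpa using hs 0
  have h1 : 1 - s ≠ 0 := sub_ne_zero.2 (by simpa using (hs 1).symm)
  rw [lowerGammaSeries_eq_even_add_odd, div_mul_eq_mul_div, mul_hyp1F2_odd hs, hyp1F2_even hs]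
  field_simp

lemma exp_mul_lowerGammaSeries_sub (hs : ∀ n : ℕ, s ≠ n) (θ x : ℂ) :
    Complex.exp (Complex.I * θ) * lowerGammaSeries x s
        - Complex.exp (-(Complex.I * θ)) * lowerGammaSeries (-x) s
      = 2 * (Complex.cos θ * (x / (1 - s))
          * hyp1F2 ((1 - s) / 2) (3 / 2) (1 + (1 - s) / 2) (x ^ 2 / 4)
        - Complex.I * Complex.sin θ * (1 / s)
          * hyp1F2 (-s / 2) (1 / 2) (1 - s / 2) (x ^ 2 / 4)) := by
  rw [lowerGammaSeries_eq_hyp1F2 hs, lowerGammaSeries_eq_hyp1F2 hs, neg_sq, mul_comm Complex.I θ,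
    ← neg_mul, Complex.exp_mul_I, Complex.exp_mul_I, Complex.cos_neg, Complex.sin_neg]
  ring

end

/-- The entire continuation in `s` of `∫_d^∞ e^{-px} x^{-s-1} dx`, where `Re p ≥ 0` and `p ≠ 0`. -/
noncomputable def expTail (p : ℂ) (d : ℝ) (s : ℂ) : ℂ :=
  p ^ s * upperIncompleteGamma (-s) (p * d)

lemma differentiable_expTail {p : ℂ} (hp : p ∈ Complex.slitPlane) {d : ℝ} (hd : 0 < d) :
    Differentiable ℂ (expTail p d) :=
  (differentiable_id.const_cpow (Or.inl (Complex.slitPlane_ne_zero hp))).mul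
    ((differentiable_upperIncompleteGamma_left (mul_ofReal_mem_slitPlane hp hd)).comp
      differentiable_neg)

lemma expTail_eq_sub {p s : ℂ} (hs : ∀ n : ℕ, s ≠ n) (hp : p ∈ Complex.slitPlane) {d : ℝ}
    (hd : 0 < d) :
    expTail p d s
      = p ^ s * Complex.Gamma (-s) - (d : ℂ) ^ (-s) * lowerGammaSeries (-(p * d)) s := by
  have hcancel : p ^ s * p ^ (-s) = 1 := by
    rw [← Complex.cpow_add _ _ (Complex.slitPlane_ne_zero hp), add_neg_cancel, Complex.cpow_zero]
  have hpd := upperIncompleteGamma_add_lowerGammaSeries hs (mul_ofReal_mem_slitPlane hp hd)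
  rw [mul_ofReal_cpow p hd] at hpd
  rw [expTail]
  linear_combination
    p ^ s * hpd - (d : ℂ) ^ (-s) * lowerGammaSeries (-(p * d)) s * hcancel

lemma exists_norm_expTail_le {c : ℝ} (hc : 0 < c) (ε : ℝ) :
    ∃ M : ℝ, 0 ≤ M ∧ ∀ p : ℂ, 0 ≤ p.re → c ≤ ‖p‖ → ∀ d, c ≤ d → ∀ s : ℂ, -ε ≤ s.re → |s.im| ≤ ε →
      ‖expTail p d s‖ ≤ d ^ (-s.re) * (M / ‖p‖) := by
  obtain ⟨M, hM0, hM⟩ := exists_norm_upperIncompleteGamma_le (mul_pos hc hc) ε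
  refine ⟨exp (π * ε) * (M * (exp (π * ε) * 1)) / c, by positivity,
    fun p hre hp d hd s hs_re hs_im => ?_⟩
  have hd0 : 0 < d := hc.trans_le hd
  have hp0 : 0 < ‖p‖ := hc.trans_le hp
  have hnorm : ‖p * d‖ = ‖p‖ * d := by rw [norm_mul, Complex.norm_real, norm_of_nonneg hd0.le]
  have hpd_re : 0 ≤ (p * d).re := by
    rw [Complex.re_mul_ofReal]
    positivity
  have hgamma := hM (-s) (p * d) (by rw [Complex.neg_re]; linarith) hpd_re
    (by rw [hnorm]; gcongr)
  have hpow : ‖p ^ s‖ ≤ exp (π * ε) * ‖p‖ ^ s.re :=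
    (norm_cpow_le_exp_mul p s).trans (by gcongr)
  rw [hnorm, Complex.neg_im, abs_neg, Complex.neg_re] at hgamma
  have hpowers : ‖p‖ ^ s.re * (‖p‖ * d) ^ (-s.re - 1) = d ^ (-s.re) / (‖p‖ * d) := by
    rw [mul_rpow hp0.le hd0.le, rpow_sub_one hp0.ne', rpow_sub_one hd0.ne', rpow_neg hp0.le]
    field_simp
  calc ‖expTail p d s‖
      ≤ exp (π * ε) * ‖p‖ ^ s.re * (M * (exp (π * ε) * 1 * (‖p‖ * d) ^ (-s.re - 1))) := by
        rw [expTail, norm_mul]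
        refine mul_le_mul hpow (hgamma.trans ?_) (norm_nonneg _) (by positivity)
        gcongr
        exact exp_le_one_iff.2 (neg_nonpos.2 hpd_re)
    _ = exp (π * ε) * (M * (exp (π * ε) * 1)) * (d ^ (-s.re) / (‖p‖ * d)) := by
        rw [← hpowers]
        ring
    _ ≤ exp (π * ε) * (M * (exp (π * ε) * 1)) * (d ^ (-s.re) / (‖p‖ * c)) := by gcongr
    _ = d ^ (-s.re) * (exp (π * ε) * (M * (exp (π * ε) * 1)) / c / ‖p‖) := by
        field_simp

/-- The angular frequency `2πka`, times `i`: the `k`-th Fourier mode of the sawtooth, evaluated at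
`ax + b`, is a combination of `e^{px}` and `e^{-px}` with `p = fourierExponent a k`. -/
noncomputable def fourierExponent (a : ℝ) (k : ℕ) : ℂ :=
  ((2 * π * k * a : ℝ) : ℂ) * Complex.I

/-- The entire continuation in `s` of `k⁻¹ ∫_d^∞ sin(2πk(ax + b)) x^{-s-1} dx`, which is the entire
extension of the paper's `F_{s,k}(a,b,d)`. -/
noncomputable def fourierTail (a b d : ℝ) (k : ℕ) (s : ℂ) : ℂ :=
  1 / (2 * Complex.I * k) *
    (Complex.exp (Complex.I * (2 * π * b * k)) * expTail (-fourierExponent a k) d s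
      - Complex.exp (-(Complex.I * (2 * π * b * k))) * expTail (fourierExponent a k) d s)

lemma fourierExponent_re (a : ℝ) (k : ℕ) : (fourierExponent a k).re = 0 := by
  rw [fourierExponent, Complex.re_ofReal_mul, Complex.I_re, mul_zero]

lemma norm_fourierExponent (a : ℝ) (k : ℕ) : ‖fourierExponent a k‖ = 2 * π * k * |a| := by
  rw [fourierExponent, norm_mul, Complex.norm_I, mul_one, Complex.norm_real, norm_mul,
    norm_of_nonneg (by positivity), Real.norm_eq_abs]

section

variable {a d : ℝ} {k : ℕ}

lemma fourierExponent_ne_zero (ha : a ≠ 0) (hk : 1 ≤ k) : fourierExponent a k ≠ 0 := by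
  have : (0 : ℝ) < k := by exact_mod_cast hk
  rw [← norm_pos_iff, norm_fourierExponent]
  positivity

lemma fourierExponent_mem_slitPlane (ha : a ≠ 0) (hk : 1 ≤ k) :
    fourierExponent a k ∈ Complex.slitPlane :=
  mem_slitPlane_of_re_nonneg (fourierExponent_re a k).ge (fourierExponent_ne_zero ha hk)

lemma neg_fourierExponent (a : ℝ) (k : ℕ) : -fourierExponent a k = fourierExponent (-a) k := by
  rw [fourierExponent, fourierExponent, mul_neg, Complex.ofReal_neg, neg_mul]

lemma differentiable_fourierTail (ha : a ≠ 0) (b : ℝ) (hd : 0 < d) (hk : 1 ≤ k) :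
    Differentiable ℂ (fourierTail a b d k) := by
  have hpos := fourierExponent_mem_slitPlane ha hk
  have hneg := fourierExponent_mem_slitPlane (neg_ne_zero.2 ha) hk
  rw [← neg_fourierExponent] at hneg
  exact (((differentiable_expTail hneg hd).const_mul _).sub
    ((differentiable_expTail hpos hd).const_mul _)).const_mul _

lemma hyperTerm_eq_lowerGammaSeries (a b : ℝ) (hd : 0 < d) (hk : 1 ≤ k) {s : ℂ}
    (hs : ∀ n : ℕ, s ≠ n) :
    hyperTerm a b d k s = -(1 / (2 * Complex.I * k) * ((d : ℂ) ^ (-s) *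
      (Complex.exp (Complex.I * (2 * π * b * k)) * lowerGammaSeries (fourierExponent a k * d) s
      - Complex.exp (-(Complex.I * (2 * π * b * k))) *
          lowerGammaSeries (-(fourierExponent a k * d)) s))) := by
  have hk0 : (k : ℂ) ≠ 0 := Nat.cast_ne_zero.2 (Nat.one_le_iff_ne_zero.1 hk)
  have hd0 : (d : ℂ) ≠ 0 := Complex.ofReal_ne_zero.2 hd.ne'
  have hcpow : (d : ℂ) ^ (1 - s) = (d : ℂ) ^ (-s) * d := by
    rw [sub_eq_neg_add, Complex.cpow_add _ _ hd0, Complex.cpow_one]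
  have hsq : -((π ^ 2 * a ^ 2 * d ^ 2 * (k : ℝ) ^ 2 : ℝ) : ℂ)
      = (fourierExponent a k * d) ^ 2 / 4 := by
    rw [fourierExponent, mul_pow, mul_pow, Complex.I_sq]
    push_cast
    ring
  have hexp := exp_mul_lowerGammaSeries_sub hs (2 * π * b * k) (fourierExponent a k * d)
  rw [hexp, hyperTerm, hsq, hcpow, Complex.cpow_neg, fourierExponent]
  generalize hyp1F2 (-s / 2) (1 / 2) (1 - s / 2) _ = even
  generalize hyp1F2 ((1 - s) / 2) (3 / 2) (1 + (1 - s) / 2) _ = odd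
  push_cast
  field_simp
  ring

lemma fourierExponent_cpow (a : ℝ) (hk : 1 ≤ k) (s : ℂ) :
    fourierExponent a k ^ s = (2 * π : ℂ) ^ s * (k : ℂ) ^ s * (Complex.I * a) ^ s := by
  have hk0 : (0 : ℝ) < k := by exact_mod_cast hk
  rw [show fourierExponent a k = Complex.I * a * ((2 * π * k : ℝ) : ℂ) by
      rw [fourierExponent]; push_cast; ring,
    mul_ofReal_cpow _ (by positivity), Complex.ofReal_mul,
    Complex.mul_cpow_ofReal_nonneg (by positivity) hk0.le]
  push_cast
  ring

lemma gammaTerm_eq_fourierExponent_cpow (a b : ℝ) (hk : 1 ≤ k) (s : ℂ) :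
    gammaTerm a b k s = 1 / (2 * Complex.I * k) *
      (Complex.exp (Complex.I * (2 * π * b * k)) *
          ((-fourierExponent a k) ^ s * Complex.Gamma (-s))
      - Complex.exp (-(Complex.I * (2 * π * b * k))) *
          (fourierExponent a k ^ s * Complex.Gamma (-s))) := by
  have hk0 : (k : ℂ) ≠ 0 := Nat.cast_ne_zero.2 (Nat.one_le_iff_ne_zero.1 hk)
  rw [gammaTerm, neg_fourierExponent, fourierExponent_cpow _ hk, fourierExponent_cpow _ hk,
    Complex.ofReal_neg, mul_neg, neg_mul, Complex.cpow_sub _ _ hk0, Complex.cpow_one]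
  field_simp

lemma fourierTail_eq_hyperTerm_add_gammaTerm (ha : a ≠ 0) (b : ℝ) (hd : 0 < d) (hk : 1 ≤ k)
    {s : ℂ} (hs : ∀ n : ℕ, s ≠ n) :
    fourierTail a b d k s = hyperTerm a b d k s + gammaTerm a b k s := by
  have hneg := fourierExponent_mem_slitPlane (neg_ne_zero.2 ha) hk
  rw [← neg_fourierExponent] at hneg
  rw [hyperTerm_eq_lowerGammaSeries a b hd hk hs, gammaTerm_eq_fourierExponent_cpow a b hk,
    fourierTail, expTail_eq_sub hs hneg hd,
    expTail_eq_sub hs (fourierExponent_mem_slitPlane ha hk) hd, neg_mul, neg_neg]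
  ring

end

lemma norm_fourierTail_le (a b d : ℝ) (k : ℕ) (s : ℂ) :
    ‖fourierTail a b d k s‖
      ≤ (‖expTail (-fourierExponent a k) d s‖ + ‖expTail (fourierExponent a k) d s‖) / (2 * k) := by
  have hphase : ‖Complex.exp (Complex.I * (2 * π * b * k))‖ = 1 := by
    rw [← Complex.norm_exp_I_mul_ofReal (2 * π * b * k)]
    push_cast
    rfl
  refine (norm_mul_le _ _).trans ?_
  rw [norm_div, norm_one, norm_mul, norm_mul, Complex.norm_two, Complex.norm_I, mul_one,
    Complex.norm_natCast, one_div, ← div_eq_inv_mul]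
  gcongr
  refine (norm_sub_le _ _).trans_eq ?_
  rw [norm_mul, norm_mul, Complex.exp_neg, norm_inv, hphase, inv_one, one_mul, one_mul]

lemma exists_norm_fourierTail_le {c : ℝ} (hc : 0 < c) (ε : ℝ) :
    ∃ M : ℝ, 0 ≤ M ∧ ∀ a b d : ℝ, c ≤ |a| → c ≤ d → ∀ s : ℂ, -ε ≤ s.re → |s.im| ≤ ε → ∀ k : ℕ,
      ‖fourierTail a b d (k + 1) s‖ ≤ d ^ (-s.re) * (M * (1 / ((k + 1 : ℕ) : ℝ) ^ 2)) := by
  obtain ⟨M, hM0, hM⟩ := exists_norm_expTail_le hc ε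
  refine ⟨M / c, by positivity, fun a b d ha hd s hs_re hs_im k => ?_⟩
  have hd0 : 0 < d := hc.trans_le hd
  have hk : (1 : ℝ) ≤ (k + 1 : ℕ) := by exact_mod_cast Nat.le_add_left 1 k
  have hfreq : c * (k + 1 : ℕ) ≤ ‖fourierExponent a (k + 1)‖ := by
    rw [norm_fourierExponent, mul_comm (2 * π * _), ← mul_assoc]
    have hpi : (1 : ℝ) ≤ 2 * π := by linarith [pi_gt_three]
    gcongr
    exact ha.trans (le_mul_of_one_le_right (abs_nonneg a) hpi)
  have hbound (p : ℂ) (hp_re : p.re = 0) (hp : ‖p‖ = ‖fourierExponent a (k + 1)‖) :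
      ‖expTail p d s‖ ≤ d ^ (-s.re) * (M / (c * (k + 1 : ℕ))) := by
    rw [← hp] at hfreq
    refine (hM p hp_re.ge ((le_mul_of_one_le_right hc.le hk).trans hfreq) d hd s hs_re
      hs_im).trans ?_
    gcongr
  have hre := fourierExponent_re a (k + 1)
  refine (norm_fourierTail_le a b d (k + 1) s).trans ((div_le_div_of_nonneg_right (add_le_add
    (hbound _ (by rw [Complex.neg_re, hre, neg_zero]) (norm_neg _)) (hbound _ hre rfl))
    (by positivity)).trans_eq ?_)
  field_simp
  norm_num

lemma summable_const_mul_inv_sq (M : ℝ) : Summable fun k : ℕ => M * (1 / ((k + 1 : ℕ) : ℝ) ^ 2) :=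
  ((summable_nat_add_iff 1).2 (Real.summable_one_div_nat_pow.2 one_lt_two)).mul_left M

lemma absUnifConvOn_of_norm_le {X : Type*} {f : ℕ → X → ℂ} {S : Set X} {u : ℕ → ℝ}
    (hu : Summable u) (h : ∀ k, ∀ x ∈ S, ‖f k x‖ ≤ u k) : AbsUnifConvOn f S :=
  ⟨fun x hx => hu.of_nonneg_of_le (fun _ => norm_nonneg _) fun k => h k x hx,
    tendstoUniformlyOn_tsum_nat hu fun k x hx => by
      rw [norm_norm]
      exact h k x hx,
    tendstoUniformlyOn_tsum_nat hu h⟩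

lemma absUnifConvOn_scaled_fourierTail {c : ℝ} (hc : 0 < c) (C ε : ℝ) :
    AbsUnifConvOn (fun k (p : ℝ × ℝ × ℝ × ℂ) =>
      (p.2.2.1 : ℂ) ^ p.2.2.2 * fourierTail p.1 p.2.1 p.2.2.1 (k + 1) p.2.2.2)
      (paramRegion c C ε) := by
  obtain ⟨M, -, hM⟩ := exists_norm_fourierTail_le hc ε
  refine absUnifConvOn_of_norm_le (summable_const_mul_inv_sq M) ?_
  rintro k ⟨a, b, d, s⟩ ⟨⟨ha, -⟩, ⟨hd, -⟩, hs_re, hs_im⟩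
  have hd0 : 0 < d := hc.trans_le hd
  calc ‖(d : ℂ) ^ s * fourierTail a b d (k + 1) s‖
      = d ^ s.re * ‖fourierTail a b d (k + 1) s‖ := by
        rw [norm_mul, Complex.norm_cpow_eq_rpow_re_of_pos hd0]
    _ ≤ d ^ s.re * (d ^ (-s.re) * (M * (1 / ((k + 1 : ℕ) : ℝ) ^ 2))) := by
        gcongr
        exact hM a b d ha hd s hs_re.le hs_im.le k
    _ = M * (1 / ((k + 1 : ℕ) : ℝ) ^ 2) := by
        rw [← mul_assoc, ← rpow_add hd0, add_neg_cancel, rpow_zero, one_mul]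

lemma rpow_neg_le_of_one_le_or_le {c C d ε σ B : ℝ} (hc : 0 < c) (hcd : c ≤ d) (hdC : d ≤ C)
    (hε : 0 < ε) (hσ : -ε ≤ σ) (h : 1 ≤ d ∨ σ ≤ B) :
    d ^ (-σ) ≤ |C| ^ ε + 1 + c⁻¹ ^ |B| := by
  have hd0 : 0 < d := hc.trans_le hcd
  have hCε : 0 ≤ |C| ^ ε := by positivity
  have hcB : 0 ≤ c⁻¹ ^ |B| := by positivity
  rcases le_or_gt 1 d with hd1 | hd1
  · have : d ^ (-σ) ≤ |C| ^ ε :=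
      (rpow_le_rpow_of_exponent_le hd1 (neg_le.1 hσ)).trans
        (rpow_le_rpow hd0.le (hdC.trans (le_abs_self C)) hε.le)
    linarith
  rcases le_total σ 0 with hσ0 | _
  · have : d ^ (-σ) ≤ 1 := rpow_le_one hd0.le hd1.le (neg_nonneg.2 hσ0)
    linarith
  · have hσB : σ ≤ |B| := (h.resolve_left hd1.not_ge).trans (le_abs_self B)
    have : d ^ (-σ) ≤ c⁻¹ ^ |B| := by
      rw [rpow_neg hd0.le, ← inv_rpow hd0.le]
      exact (rpow_le_rpow_of_exponent_le ((one_le_inv₀ hd0).2 hd1.le) hσB).trans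
        (rpow_le_rpow (inv_nonneg.2 hd0.le) (inv_anti₀ hc hcd) (abs_nonneg B))
    linarith

lemma absUnifConvOn_fourierTail {c C ε : ℝ} (hc : 0 < c) (hε : 0 < ε) (B : ℝ) :
    AbsUnifConvOn (fun k (p : ℝ × ℝ × ℝ × ℂ) => fourierTail p.1 p.2.1 p.2.2.1 (k + 1) p.2.2.2)
      (paramRegion c C ε ∩ {p | 1 ≤ p.2.2.1 ∨ p.2.2.2.re ≤ B}) := by
  obtain ⟨M, hM0, hM⟩ := exists_norm_fourierTail_le hc ε
  refine absUnifConvOn_of_norm_le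
    ((summable_const_mul_inv_sq M).mul_left (|C| ^ ε + 1 + c⁻¹ ^ |B|)) ?_
  rintro k ⟨a, b, d, s⟩ ⟨⟨⟨ha, -⟩, ⟨hd, hdC⟩, hs_re, hs_im⟩, hB⟩
  exact (hM a b d ha hd s hs_re.le hs_im.le k).trans (mul_le_mul_of_nonneg_right
    (rpow_neg_le_of_one_le_or_le hc hd hdC hε hs_re.le hB) (by positivity))

lemma rpow_le_rpow_add_rpow_neg {d R x : ℝ} (hd : 0 < d) (hx : |x| ≤ R) :
    d ^ x ≤ d ^ R + d ^ (-R) := by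
  obtain ⟨hneg, hpos⟩ := abs_le.1 hx
  rcases le_total 1 d with h | h
  · linarith [rpow_le_rpow_of_exponent_le h hpos, rpow_pos_of_pos hd (-R)]
  · linarith [rpow_le_rpow_of_exponent_ge hd h hneg, rpow_pos_of_pos hd R]

section

variable {a d : ℝ} (ha : a ≠ 0) (b : ℝ) (hd : 0 < d)

include ha hd

lemma exists_summable_norm_fourierTail_le (R : ℝ) :
    ∃ u : ℕ → ℝ, Summable u ∧ ∀ k, ∀ s ∈ Metric.ball 0 R,
      ‖fourierTail a b d (k + 1) s‖ ≤ u k := by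
  obtain ⟨M, hM0, hM⟩ := exists_norm_fourierTail_le (lt_min (abs_pos.2 ha) hd) R
  refine ⟨fun k => (d ^ R + d ^ (-R)) * (M * (1 / ((k + 1 : ℕ) : ℝ) ^ 2)),
    (summable_const_mul_inv_sq M).mul_left _, fun k s hs => ?_⟩
  have hs := (mem_ball_zero_iff.1 hs).le
  have hre := (Complex.abs_re_le_norm s).trans hs
  refine (hM a b d (min_le_left _ _) (min_le_right _ _) s (abs_le.1 hre).1
    ((Complex.abs_im_le_norm s).trans hs) k).trans (mul_le_mul_of_nonneg_right ?_ (by positivity))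
  exact rpow_le_rpow_add_rpow_neg hd (by rwa [abs_neg])

lemma summable_norm_fourierTail (s : ℂ) : Summable fun k : ℕ => ‖fourierTail a b d (k + 1) s‖ := by
  obtain ⟨u, hu, h⟩ := exists_summable_norm_fourierTail_le ha b hd (‖s‖ + 1)
  exact hu.of_nonneg_of_le (fun _ => norm_nonneg _) fun k => h k s (by simp)

lemma differentiable_tsum_fourierTail :
    Differentiable ℂ fun s => ∑' k : ℕ, fourierTail a b d (k + 1) s := by
  intro s
  obtain ⟨u, hu, h⟩ := exists_summable_norm_fourierTail_le ha b hd (‖s‖ + 1)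
  exact (Complex.differentiableOn_tsum_of_summable_norm hu
    (fun k => (differentiable_fourierTail ha b hd (Nat.le_add_left 1 k)).differentiableOn)
    Metric.isOpen_ball h).differentiableAt (Metric.isOpen_ball.mem_nhds (by simp))

end

section

variable {a d : ℝ} (ha : a ≠ 0) (b : ℝ) (hd : 0 < d)

lemma integrableOn_Ioi_cpow_neg_sub_one {s : ℂ} (hs : 0 < s.re) (hd : 0 < d) :
    IntegrableOn (fun x : ℝ => (x : ℂ) ^ (-s - 1)) (Ioi d) :=
  integrableOn_Ioi_cpow_of_lt (by rw [Complex.sub_re, Complex.neg_re, Complex.one_re]; linarith) hd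

lemma exp_mul_exp_fourierExponent_sub (a b : ℝ) (k : ℕ) (x : ℝ) :
    Complex.exp (Complex.I * (2 * π * b * k)) * Complex.exp (fourierExponent a k * x)
        - Complex.exp (-(Complex.I * (2 * π * b * k))) * Complex.exp (-(fourierExponent a k * x))
      = 2 * Complex.I * (sin (2 * π * k * (a * x + b)) : ℝ) := by
  have hphase : Complex.I * (2 * π * b * k) + fourierExponent a k * x
      = ((2 * π * k * (a * x + b) : ℝ) : ℂ) * Complex.I := by
    rw [fourierExponent]
    push_cast
    ring
  rw [← Complex.exp_add, ← Complex.exp_add, ← neg_add, hphase, ← neg_mul, Complex.exp_mul_I,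
    Complex.exp_mul_I, Complex.cos_neg, Complex.sin_neg, Complex.ofReal_sin]
  ring

include ha hd

lemma fourierTail_eq_integral {k : ℕ} (hk : 1 ≤ k) {s : ℂ} (hs : 0 < s.re) :
    fourierTail a b d k s
      = ∫ x in Ioi d, ((sin (2 * π * k * (a * x + b)) / k : ℝ) : ℂ) * (x : ℂ) ^ (-s - 1) := by
  set p := fourierExponent a k with hp
  have hp0 : p ≠ 0 := fourierExponent_ne_zero ha hk
  have hre : p.re = 0 := fourierExponent_re a k
  have hre_neg : 0 ≤ (-p).re := by rw [Complex.neg_re, hre, neg_zero]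
  rw [fourierTail, expTail, expTail, ← hp,
    cpow_mul_upperIncompleteGamma_eq_integral hre_neg (neg_ne_zero.2 hp0) hs hd,
    cpow_mul_upperIncompleteGamma_eq_integral hre.ge hp0 hs hd, ← integral_const_mul,
    ← integral_const_mul, ← integral_sub ((integrableOn_exp_neg_mul_cpow hre_neg hs hd).const_mul _)
      ((integrableOn_exp_neg_mul_cpow hre.ge hs hd).const_mul _), ← integral_const_mul]
  congr 1 with x
  have hk0 : (k : ℂ) ≠ 0 := Nat.cast_ne_zero.2 (Nat.one_le_iff_ne_zero.1 hk)
  have hsin := exp_mul_exp_fourierExponent_sub a b k x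
  rw [← hp] at hsin
  rw [neg_mul, neg_neg, Complex.ofReal_div, Complex.ofReal_natCast]
  calc _ = 1 / (2 * Complex.I * k) * ((Complex.exp (Complex.I * (2 * π * b * k))
          * Complex.exp (p * x) - Complex.exp (-(Complex.I * (2 * π * b * k)))
          * Complex.exp (-(p * x))) * (x : ℂ) ^ (-s - 1)) := by ring
    _ = _ := by
      rw [hsin]
      field_simp

lemma sum_fourierTail_eq_integral {s : ℂ} (hs : 0 < s.re) (N : ℕ) :
    ∑ k ∈ Finset.range N, fourierTail a b d (k + 1) s
      = ∫ x in Ioi d, (sawSum N (a * x + b) : ℂ) * (x : ℂ) ^ (-s - 1) := by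
  have hInt (k : ℕ) : IntegrableOn
      (fun x : ℝ => ((sin (2 * π * k * (a * x + b)) / k : ℝ) : ℂ) * (x : ℂ) ^ (-s - 1))
      (Ioi d) := by
    refine (integrableOn_Ioi_cpow_neg_sub_one hs hd).bdd_mul (c := 1 / k)
      (by fun_prop : Continuous _).aestronglyMeasurable (Eventually.of_forall fun x => ?_)
    rw [Complex.norm_real, norm_div, Real.norm_eq_abs, RCLike.norm_natCast]
    gcongr
    exact abs_sin_le_one _
  rw [Finset.sum_congr rfl fun k _ => fourierTail_eq_integral ha b hd (Nat.le_add_left 1 k) hs,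
    ← integral_finsetSum _ fun k _ => hInt (k + 1)]
  congr 1 with x
  rw [sawSum, Complex.ofReal_sum, Finset.sum_mul]
  push_cast
  rfl

lemma tsum_fourierTail_eq_integral {s : ℂ} (hs : 0 < s.re) :
    ∑' k : ℕ, fourierTail a b d (k + 1) s
      = ∫ x in Ioi d, (saw (a * x + b) : ℂ) * (x : ℂ) ^ (-s - 1) := by
  have hInt := integrableOn_Ioi_cpow_neg_sub_one hs hd
  have hlim := (summable_norm_fourierTail ha b hd s).of_norm.hasSum.tendsto_sum_nat
  simp_rw [sum_fourierTail_eq_integral ha b hd hs] at hlim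
  refine tendsto_nhds_unique hlim (tendsto_integral_filter_of_dominated_convergence
    (fun x => 8 * ‖(x : ℂ) ^ (-s - 1)‖) (Eventually.of_forall fun N => ?_)
    (Eventually.of_forall fun N => Eventually.of_forall fun x => ?_) (hInt.norm.const_mul 8)
    (Eventually.of_forall fun x => ?_))
  · exact (Complex.continuous_ofReal.comp ((continuous_sawSum N).comp
      (by fun_prop))).aestronglyMeasurable.mul hInt.aestronglyMeasurable
  · rw [norm_mul, Complex.norm_real, Real.norm_eq_abs]
    gcongr
    exact abs_sawSum_le _ _
  · exact ((Complex.continuous_ofReal.tendsto _).comp (tendsto_sawSum _)).mul_const _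

end

lemma ae_saw_eq {a : ℝ} (ha : a ≠ 0) (b : ℝ) :
    ∀ᵐ x : ℝ, saw (a * x + b)
      = π * (1 / 2 - Int.fract b - a * x + ⌊a * x + Int.fract b⌋) := by
  filter_upwards [(countable_range fun m : ℤ => ((m : ℝ) - b) / a).ae_notMem volume] with x hx
  have hfract : Int.fract (a * x + b) ≠ 0 := by
    intro h
    obtain ⟨m, hm⟩ := Int.fract_eq_zero_iff.1 h
    exact hx ⟨m, by simp only [hm, add_sub_cancel_right, mul_div_cancel_left₀ x ha]⟩
  have hshift : Int.fract (a * x + b) = Int.fract (a * x + Int.fract b) := by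
    rw [← Int.self_sub_floor b, ← add_sub_assoc, Int.fract_sub_intCast]
  rw [saw, if_neg hfract, hshift, ← Int.self_sub_floor (a * x + Int.fract b)]
  ring

lemma ae_saw_mul_cpow_eq {a : ℝ} (ha : a ≠ 0) (b : ℝ) (s : ℂ) :
    ∀ᵐ x : ℝ, 0 < x → (saw (a * x + b) : ℂ) * (x : ℂ) ^ (-s - 1)
      = (π * (1 / 2 - Int.fract b) : ℂ) * (x : ℂ) ^ (-s - 1) - (π * a : ℂ) * (x : ℂ) ^ (-s)
        + π * ((⌊a * x + Int.fract b⌋ : ℂ) * (x : ℂ) ^ (-s - 1)) := by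
  filter_upwards [ae_saw_eq ha b] with x hx hpos
  have hx0 : (x : ℂ) ≠ 0 := Complex.ofReal_ne_zero.2 hpos.ne'
  have hpow : (x : ℂ) ^ (-s) = x * (x : ℂ) ^ (-s - 1) := by
    rw [Complex.cpow_sub _ _ hx0, Complex.cpow_one, mul_div_cancel₀ _ hx0]
  rw [hx, hpow]
  push_cast
  ring

lemma norm_floor_le (y : ℝ) : ‖(⌊y⌋ : ℂ)‖ ≤ |y| + 1 := by
  rw [Complex.norm_intCast, abs_le]
  have hle := Int.floor_le y
  have hlt := Int.lt_floor_add_one y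
  constructor <;> linarith [neg_abs_le y, le_abs_self y]

lemma integrableOn_floor_mul_cpow (a β : ℝ) {d : ℝ} (hd : 0 < d) {s : ℂ} (hs : 1 < s.re) :
    IntegrableOn (fun x : ℝ => (⌊a * x + β⌋ : ℂ) * (x : ℂ) ^ (-s - 1)) (Ioi d) := by
  have hpow := integrableOn_Ioi_cpow_neg_sub_one (zero_lt_one.trans hs) hd
  have hmeas : Measurable fun x : ℝ => (⌊a * x + β⌋ : ℂ) :=
    (measurable_of_countable (fun n : ℤ => (n : ℂ))).comp (by fun_prop)
  refine Integrable.mono' (((integrableOn_Ioi_rpow_of_lt (neg_lt_neg hs) hd).const_mul |a|).add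
    (hpow.norm.const_mul (|β| + 1))) (hmeas.aestronglyMeasurable.mul hpow.aestronglyMeasurable)
    ((ae_restrict_iff' measurableSet_Ioi).2 (Eventually.of_forall fun x hx => ?_))
  have hx0 : 0 < x := hd.trans hx
  have hfloor : ‖(⌊a * x + β⌋ : ℂ)‖ ≤ |a| * x + (|β| + 1) := by
    have habs := abs_add_le (a * x) β
    rw [abs_mul, abs_of_pos hx0] at habs
    linarith [norm_floor_le (a * x + β)]
  have hnorm : x ^ (-s.re) = x * ‖(x : ℂ) ^ (-s - 1)‖ := by
    rw [Complex.norm_cpow_eq_rpow_re_of_pos hx0, Complex.sub_re, Complex.neg_re, Complex.one_re,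
      rpow_sub_one hx0.ne', mul_div_cancel₀ _ hx0.ne']
  calc ‖(⌊a * x + β⌋ : ℂ) * (x : ℂ) ^ (-s - 1)‖
      ≤ (|a| * x + (|β| + 1)) * ‖(x : ℂ) ^ (-s - 1)‖ := by
        rw [norm_mul]
        gcongr
    _ = |a| * x ^ (-s.re) + (|β| + 1) * ‖(x : ℂ) ^ (-s - 1)‖ := by
        rw [hnorm]
        ring

lemma tsum_indicator_Ici_eq_floor_mul {a β x : ℝ} (ha : 0 < a) (hx : 0 ≤ a * x + β) (c : ℂ) :
    ∑' n : ℕ, (Ici ((n + (1 - β)) / a)).indicator (fun _ => c) x = (⌊a * x + β⌋ : ℂ) * c := by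
  have hmem (n : ℕ) : x ∈ Ici ((n + (1 - β)) / a) ↔ n < ⌊a * x + β⌋₊ := by
    rw [mem_Ici, div_le_iff₀ ha, Nat.lt_iff_add_one_le, Nat.le_floor_iff hx]
    push_cast
    constructor <;> intro <;> linarith
  have hfloor : (⌊a * x + β⌋₊ : ℂ) = ⌊a * x + β⌋ := by
    exact_mod_cast congrArg (Int.cast (R := ℂ)) (Int.natCast_floor_eq_floor hx)
  rw [tsum_eq_sum (s := Finset.range ⌊a * x + β⌋₊) fun n hn =>
      indicator_of_notMem (fun h => hn (Finset.mem_range.2 ((hmem n).1 h))) _,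
    Finset.sum_congr rfl fun n hn => indicator_of_mem ((hmem n).2 (Finset.mem_range.1 hn)) _,
    Finset.sum_const, Finset.card_range, nsmul_eq_mul, hfloor]

lemma integral_Ioi_zero_indicator_Ici {E : Type*} [NormedAddCommGroup E] [NormedSpace ℝ E]
    {p : ℝ} (hp : 0 < p) (f : ℝ → E) :
    ∫ x in Ioi 0, (Ici p).indicator f x = ∫ x in Ioi p, f x := by
  rw [setIntegral_indicator measurableSet_Ici, inter_eq_right.2 (Ici_subset_Ioi.2 hp),
    integral_Ici_eq_integral_Ioi]

lemma integral_Ioi_cpow_neg_sub_one {s : ℂ} (hs : 0 < s.re) {p : ℝ} (hp : 0 < p) :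
    ∫ x in Ioi p, (x : ℂ) ^ (-s - 1) = (p : ℂ) ^ (-s) / s := by
  rw [integral_Ioi_cpow_of_lt (by rw [Complex.sub_re, Complex.neg_re, Complex.one_re]; linarith) hp,
    sub_add_cancel, neg_div_neg_eq]

lemma integral_Ioi_norm_cpow_neg_sub_one {s : ℂ} (hs : 0 < s.re) {p : ℝ} (hp : 0 < p) :
    ∫ x in Ioi p, ‖(x : ℂ) ^ (-s - 1)‖ = ‖(p : ℂ) ^ (-s)‖ / s.re := by
  rw [setIntegral_congr_fun measurableSet_Ioi fun x hx =>
      Complex.norm_cpow_eq_rpow_re_of_pos (hp.trans hx) _,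
    Complex.norm_cpow_eq_rpow_re_of_pos hp, Complex.sub_re, Complex.neg_re, Complex.one_re,
    integral_Ioi_rpow_of_lt (by linarith) hp, sub_add_cancel, neg_div_neg_eq]

lemma div_cpow_neg {x a : ℝ} (hx : 0 ≤ x) (ha : 0 ≤ a) (s : ℂ) :
    ((x / a : ℝ) : ℂ) ^ (-s) = (a : ℂ) ^ s * (1 / (x : ℂ) ^ s) := by
  rw [Complex.cpow_neg, Complex.ofReal_div, Complex.div_cpow_ofReal_nonneg hx ha, inv_div,
    div_eq_mul_one_div]

lemma integral_floor_mul_cpow {a β : ℝ} (ha : 0 < a) (h0 : 0 ≤ β) (h1 : β < 1) {s : ℂ}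
    (hs : 1 < s.re) :
    ∫ x in Ioi (0 : ℝ), (⌊a * x + β⌋ : ℂ) * (x : ℂ) ^ (-s - 1)
      = (a : ℂ) ^ s / s * HurwitzZeta.hurwitzZeta ((1 - β : ℝ) : UnitAddCircle) s := by
  have hs0 : 0 < s.re := zero_lt_one.trans hs
  have hzeta := HurwitzZeta.hasSum_hurwitzZeta_of_one_lt_re (a := 1 - β)
    ⟨by linarith, by linarith⟩ hs
  have hnum (n : ℕ) : 0 < n + (1 - β) := add_pos_of_nonneg_of_pos n.cast_nonneg (by linarith)
  have hjump (n : ℕ) : 0 < (n + (1 - β)) / a := div_pos (hnum n) ha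
  have hpow (n : ℕ) : (((n + (1 - β)) / a : ℝ) : ℂ) ^ (-s)
      = (a : ℂ) ^ s * (1 / ((n : ℂ) + (1 - β : ℝ)) ^ s) := by
    rw [div_cpow_neg (hnum n).le ha.le, Complex.ofReal_add, Complex.ofReal_natCast]
  set F : ℕ → ℝ → ℂ := fun n =>
    (Ici ((n + (1 - β)) / a)).indicator fun x => (x : ℂ) ^ (-s - 1) with hF
  have hInt (n : ℕ) : Integrable (F n) (volume.restrict (Ioi 0)) :=
    ((integrable_indicator_iff measurableSet_Ici).2 ((integrableOn_Ici_iff_integrableOn_Ioi).2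
      (integrableOn_Ioi_cpow_neg_sub_one hs0 (hjump n)))).restrict
  have hval (n : ℕ) : ∫ x in Ioi (0 : ℝ), F n x
      = (a : ℂ) ^ s / s * (1 / ((n : ℂ) + (1 - β : ℝ)) ^ s) := by
    rw [integral_Ioi_zero_indicator_Ici (hjump n), integral_Ioi_cpow_neg_sub_one hs0 (hjump n),
      hpow, mul_div_right_comm]
  have hnorm (n : ℕ) : ∫ x in Ioi (0 : ℝ), ‖F n x‖
      = ‖(a : ℂ) ^ s‖ / s.re * ‖1 / ((n : ℂ) + (1 - β : ℝ)) ^ s‖ := by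
    simp only [hF, norm_indicator_eq_indicator_norm]
    rw [integral_Ioi_zero_indicator_Ici (hjump n), integral_Ioi_norm_cpow_neg_sub_one hs0 (hjump n),
      hpow, norm_mul, mul_div_right_comm]
  have hsum := hasSum_integral_of_summable_integral_norm hInt (by
    simp_rw [hnorm]
    exact hzeta.summable.norm.mul_left _)
  simp_rw [hval] at hsum
  rw [(hzeta.mul_left ((a : ℂ) ^ s / s)).unique hsum]
  refine setIntegral_congr_fun measurableSet_Ioi fun x hx => ?_
  exact (tsum_indicator_Ici_eq_floor_mul ha
    (add_nonneg (mul_nonneg ha.le (mem_Ioi.1 hx).le) h0) _).symm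

lemma integral_Ioi_floor_mul_cpow {a : ℝ} (ha : 0 < a) (b : ℝ) {d : ℝ} (hd : 0 < d) {s : ℂ}
    (hs : 1 < s.re) :
    s * ∫ x in Ioi d, (⌊a * x + Int.fract b⌋ : ℂ) * (x : ℂ) ^ (-s - 1)
      = (a : ℂ) ^ s * HurwitzZeta.hurwitzZeta ((1 - Int.fract b : ℝ) : UnitAddCircle) s
        + floorRemainder a b d s := by
  have hβ0 := Int.fract_nonneg b
  have hβ1 := Int.fract_lt_one b
  rw [floorRemainder]
  set β := Int.fract b
  set f : ℝ → ℂ := fun x => (⌊a * x + β⌋ : ℂ) * (x : ℂ) ^ (-s - 1) with hf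
  have hjump : 0 < (1 - β) / a := div_pos (by linarith) ha
  have hInt {c : ℝ} (hc : 0 < c) : IntegrableOn f (Ioi c) := integrableOn_floor_mul_cpow a β hc hs
  have hvanish : ∫ x in Ioi 0, f x = ∫ x in Ioi ((1 - β) / a), f x := by
    rw [← integral_Ici_eq_integral_Ioi (x := (1 - β) / a)]
    refine setIntegral_eq_of_subset_of_forall_sdiff_eq_zero measurableSet_Ioi
      (Ici_subset_Ioi.2 hjump) fun x hx => ?_
    have hx0 : 0 < x := hx.1
    have hx1 : x < (1 - β) / a := not_le.1 hx.2
    rw [lt_div_iff₀ ha] at hx1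
    have hfloor : ⌊a * x + β⌋ = 0 := Int.floor_eq_zero_iff.2 ⟨by positivity, by linarith⟩
    rw [hf]
    simp only [hfloor, Int.cast_zero, zero_mul]
  have hzeta : (a : ℂ) ^ s * HurwitzZeta.hurwitzZeta ((1 - β : ℝ) : UnitAddCircle) s
      = s * ∫ x in Ioi ((1 - β) / a), f x := by
    rw [← hvanish, integral_floor_mul_cpow ha hβ0 hβ1 hs, ← mul_assoc,
      mul_div_cancel₀ _ (Complex.ne_zero_of_one_lt_re hs)]
  rw [hzeta, ← intervalIntegral.integral_Ioi_sub_Ioi' (hInt one_pos) (hInt hd),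
    ← intervalIntegral.integral_Ioi_sub_Ioi' (hInt one_pos) (hInt hjump)]
  ring

lemma zetaSide_eq_tsum_of_pos {a : ℝ} (ha : 0 < a) (b : ℝ) {d : ℝ} (hd : 0 < d) {s : ℂ}
    (hs : 1 < s.re) :
    zetaSide a b d s = ∑' k : ℕ, fourierTail a b d (k + 1) s := by
  have hs_pos : 0 < s.re := zero_lt_one.trans hs
  have hs0 : s ≠ 0 := Complex.ne_zero_of_one_lt_re hs
  have hs1 : s - 1 ≠ 0 := sub_ne_zero.2 fun h => by simp [h] at hs
  have hre : (-s).re < -1 := by rw [Complex.neg_re]; linarith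
  have hpow := (integrableOn_Ioi_cpow_neg_sub_one hs_pos hd).const_mul (π * (1 / 2 - Int.fract b))
  have hlin := (integrableOn_Ioi_cpow_of_lt hre hd).const_mul (π * a : ℂ)
  have hfloor := (integrableOn_floor_mul_cpow a (Int.fract b) hd hs).const_mul (π : ℂ)
  have hint_floor : ∫ x in Ioi d, (⌊a * x + Int.fract b⌋ : ℂ) * (x : ℂ) ^ (-s - 1)
      = ((a : ℂ) ^ s * HurwitzZeta.hurwitzZeta ((1 - Int.fract b : ℝ) : UnitAddCircle) s
        + floorRemainder a b d s) / s := by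
    rw [← integral_Ioi_floor_mul_cpow ha b hd hs, mul_div_cancel_left₀ _ hs0]
  have hint_lin : ∫ x in Ioi d, (x : ℂ) ^ (-s) = d * (d : ℂ) ^ (-s) / (s - 1) := by
    rw [integral_Ioi_cpow_of_lt hre hd, Complex.cpow_add _ _ (Complex.ofReal_ne_zero.2 hd.ne'),
      Complex.cpow_one, mul_comm (d : ℂ), ← neg_div_neg_eq (_ * _)]
    ring
  rw [tsum_fourierTail_eq_integral ha.ne' b hd hs_pos,
    setIntegral_congr_ae measurableSet_Ioi
      ((ae_saw_mul_cpow_eq ha.ne' b s).mono fun x hx hxd => hx (hd.trans hxd)),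
    integral_add (by exact hpow.sub hlin) hfloor, integral_sub hpow hlin, integral_const_mul,
    integral_const_mul, integral_const_mul, integral_Ioi_cpow_neg_sub_one hs_pos hd, hint_lin,
    hint_floor, zetaSide, if_pos ha]
  field_simp
  ring

lemma zetaSide_of_neg {a : ℝ} (ha : a < 0) (b d : ℝ) (s : ℂ) :
    zetaSide a b d s = -zetaSide (-a) (-b) d s := by
  have hpole : (a * d * s / (1 - s) : ℂ) = ((-a : ℝ) : ℂ) * d * s / (s - 1) := by
    rw [← neg_sub s 1, div_neg, Complex.ofReal_neg, neg_mul, neg_mul, neg_div]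
  rw [zetaSide, zetaSide, if_neg (not_lt.2 ha.le), if_pos (neg_pos.2 ha), hpole]
  push_cast
  ring

lemma fourierTail_neg_neg (a b d : ℝ) (k : ℕ) (s : ℂ) :
    fourierTail (-a) (-b) d k s = -fourierTail a b d k s := by
  have hphase : Complex.I * (2 * π * ((-b : ℝ) : ℂ) * k) = -(Complex.I * (2 * π * b * k)) := by
    push_cast
    ring
  rw [fourierTail, fourierTail, ← neg_fourierExponent, hphase, neg_neg, neg_neg]
  ring

lemma zetaSide_eq_tsum {a : ℝ} (ha : a ≠ 0) (b : ℝ) {d : ℝ} (hd : 0 < d) {s : ℂ}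
    (hs : 1 < s.re) :
    zetaSide a b d s = ∑' k : ℕ, fourierTail a b d (k + 1) s := by
  rcases ha.lt_or_gt with hneg | hpos
  · rw [zetaSide_of_neg hneg, zetaSide_eq_tsum_of_pos (neg_pos.2 hneg) (-b) hd hs, ← tsum_neg]
    exact tsum_congr fun k => by rw [fourierTail_neg_neg, neg_neg]
  · exact zetaSide_eq_tsum_of_pos hpos b hd hs

lemma intervalIntegrable_sin_sub_mul_cpow (a b : ℝ) (k : ℕ) {s : ℂ} (hre : s.re < 1) (hs : s ≠ 0) :
    IntervalIntegrable (fun x : ℝ => ((sin (2 * π * k * (a * x + b)) / k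
      - sin (2 * π * k * b) / k : ℝ) : ℂ) * (x : ℂ) ^ (-s - 1)) volume 0 1 := by
  convert intervalIntegrable_sub_mul_cpow
    (f := fun z => Complex.sin (2 * π * k * (a * z + b)) / k) (by fun_prop) hre hs using 2 with x
  push_cast
  rw [mul_zero, zero_add]

lemma exp_sub_exp_neg_eq_sin (b : ℝ) (k : ℕ) :
    Complex.exp (Complex.I * (2 * π * b * k)) - Complex.exp (-(Complex.I * (2 * π * b * k)))
      = 2 * Complex.I * (sin (2 * π * k * b) : ℝ) := by
  simpa only [Complex.ofReal_zero, mul_zero, neg_zero, Complex.exp_zero, mul_one, zero_add]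
    using exp_mul_exp_fourierExponent_sub 0 b k 0

lemma sin_div_sub_sin_div_mul_eq_exp (a b : ℝ) {k : ℕ} (hk : 1 ≤ k) (x : ℝ) (w : ℂ) :
    ((sin (2 * π * k * (a * x + b)) / k - sin (2 * π * k * b) / k : ℝ) : ℂ) * w
      = 1 / (2 * Complex.I * k)
        * (Complex.exp (Complex.I * (2 * π * b * k))
            * ((Complex.exp (fourierExponent a k * x) - 1) * w)
          - Complex.exp (-(Complex.I * (2 * π * b * k)))
            * ((Complex.exp (-fourierExponent a k * x) - 1) * w)) := by
  have hk0 : (k : ℂ) ≠ 0 := Nat.cast_ne_zero.2 (Nat.one_le_iff_ne_zero.1 hk)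
  have hsin := exp_mul_exp_fourierExponent_sub a b k x
  have hsin0 := exp_sub_exp_neg_eq_sin b k
  rw [Complex.ofReal_sub, Complex.ofReal_div, Complex.ofReal_div, Complex.ofReal_natCast, neg_mul]
  set θ : ℂ := 2 * π * b * k
  field_simp
  linear_combination w * (hsin0 - hsin)

lemma neg_hyperTerm_eq_integral (a b : ℝ) {k : ℕ} (hk : 1 ≤ k) {s : ℂ} (hre : s.re < 1)
    (hs : s ≠ 0) :
    -hyperTerm a b 1 k s
      = (∫ x in (0 : ℝ)..1, ((sin (2 * π * k * (a * x + b)) / k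
          - sin (2 * π * k * b) / k : ℝ) : ℂ) * (x : ℂ) ^ (-s - 1))
        - ((sin (2 * π * k * b) / k : ℝ) : ℂ) / s := by
  have hk0 : (k : ℂ) ≠ 0 := Nat.cast_ne_zero.2 (Nat.one_le_iff_ne_zero.1 hk)
  have hsin0 := exp_sub_exp_neg_eq_sin b k
  have hInt (q : ℂ) (c : ℂ) := (intervalIntegrable_sub_mul_cpow
    (f := fun x => Complex.exp (q * x)) (by fun_prop) hre hs).const_mul c
  simp only [mul_zero, Complex.exp_zero] at hInt
  rw [hyperTerm_eq_lowerGammaSeries a b one_pos hk (ne_natCast_of_re_lt_one hre hs)]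
  simp_rw [sin_div_sub_sin_div_mul_eq_exp a b hk]
  set p := fourierExponent a k
  set θ : ℂ := 2 * π * b * k
  rw [intervalIntegral.integral_const_mul, intervalIntegral.integral_sub (hInt p _) (hInt (-p) _),
    intervalIntegral.integral_const_mul, intervalIntegral.integral_const_mul,
    integral_exp_sub_one_mul_cpow p hre hs, integral_exp_sub_one_mul_cpow (-p) hre hs,
    Complex.ofReal_div, Complex.ofReal_natCast, Complex.ofReal_one, Complex.one_cpow, mul_one]
  field_simp
  linear_combination -hsin0

lemma sum_neg_hyperTerm (a b : ℝ) {s : ℂ} (hre : s.re < 1) (hs : s ≠ 0) (N : ℕ) :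
    ∑ k ∈ Finset.range N, -hyperTerm a b 1 (k + 1) s
      = (∫ x in (0 : ℝ)..1, ((sawSum N (a * x + b) - sawSum N b : ℝ) : ℂ) * (x : ℂ) ^ (-s - 1))
        - (sawSum N b : ℂ) / s := by
  rw [Finset.sum_congr rfl fun k _ =>
      neg_hyperTerm_eq_integral a b (Nat.le_add_left 1 k) hre hs,
    Finset.sum_sub_distrib, ← intervalIntegral.integral_finsetSum fun k _ =>
      intervalIntegrable_sin_sub_mul_cpow a b (k + 1) hre hs]
  congr 1
  · refine intervalIntegral.integral_congr fun x _ => ?_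
    simp only [sawSum]
    rw [← Finset.sum_mul, ← Finset.sum_sub_distrib, Complex.ofReal_sum]
    push_cast
    rfl
  · rw [sawSum, Complex.ofReal_sum, Finset.sum_div]
    push_cast
    rfl

lemma intervalIntegral_zero_one_cpow {r : ℂ} (hr : -1 < r.re) :
    ∫ x in (0 : ℝ)..1, (x : ℂ) ^ r = (r + 1)⁻¹ := by
  have hne : r + 1 ≠ 0 := fun h => by
    rw [eq_neg_of_add_eq_zero_left h, Complex.neg_re, Complex.one_re] at hr
    exact hr.false
  rw [integral_cpow (Or.inl hr), Complex.ofReal_zero, Complex.zero_cpow hne, Complex.ofReal_one,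
    Complex.one_cpow, sub_zero, one_div]

lemma intervalIntegral_const_mul_cpow_neg_sub_one {κ s : ℂ} (h : κ = 0 ∨ s.re < 0) :
    IntervalIntegrable (fun x : ℝ => κ * (x : ℂ) ^ (-s - 1)) volume 0 1 ∧
      ∫ x in (0 : ℝ)..1, κ * (x : ℂ) ^ (-s - 1) = -(κ / s) := by
  rcases h with rfl | hs
  · simp
  · have hre : -1 < (-s - 1).re := by
      rw [Complex.sub_re, Complex.neg_re, Complex.one_re]
      linarith
    refine ⟨(intervalIntegral.intervalIntegrable_cpow' hre).const_mul κ, ?_⟩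
    rw [intervalIntegral.integral_const_mul, intervalIntegral_zero_one_cpow hre, sub_add_cancel,
      inv_neg, mul_neg, div_eq_mul_inv]

lemma ae_floor_eq_zero {a : ℝ} (ha : a ≠ 0) (b : ℝ) :
    ∀ᵐ x : ℝ, x ∈ uIoc 0 ((1 - Int.fract b) / a) → ⌊a * x + Int.fract b⌋ = 0 := by
  filter_upwards [(countable_singleton ((1 - Int.fract b) / a)).ae_notMem volume] with x hne hx
  have hmem : a * x ∈ uIcc (a * 0) (a * ((1 - Int.fract b) / a)) := by
    rw [← image_const_mul_uIcc]
    exact mem_image_of_mem _ (uIoc_subset_uIcc hx)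
  have hlt := Int.fract_lt_one b
  rw [mul_zero, mul_div_cancel₀ _ ha, uIcc_of_le (by linarith)] at hmem
  have hne' : a * x ≠ 1 - Int.fract b := fun h => hne (by rw [mem_singleton_iff, ← h]; field_simp)
  have hax := lt_of_le_of_ne hmem.2 hne'
  exact Int.floor_eq_zero_iff.2 ⟨add_nonneg hmem.1 (Int.fract_nonneg b), by linarith⟩

lemma floorRemainder_one {a : ℝ} (ha : a ≠ 0) (b : ℝ) {s : ℂ}
    (hInt : IntervalIntegrable (fun x : ℝ => (⌊a * x + Int.fract b⌋ : ℂ) * (x : ℂ) ^ (-s - 1))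
      volume 0 1) :
    floorRemainder a b 1 s
      = -(s * ∫ x in (0 : ℝ)..1, (⌊a * x + Int.fract b⌋ : ℂ) * (x : ℂ) ^ (-s - 1)) := by
  set f : ℝ → ℂ := fun x => (⌊a * x + Int.fract b⌋ : ℂ) * (x : ℂ) ^ (-s - 1) with hf
  have hzero : ∀ᵐ x : ℝ, x ∈ uIoc 0 ((1 - Int.fract b) / a) → 0 = f x := by
    filter_upwards [ae_floor_eq_zero ha b] with x hx hmem
    rw [hf]
    simp only [hx hmem, Int.cast_zero, zero_mul]
  have hInt_zero : IntervalIntegrable f volume 0 ((1 - Int.fract b) / a) :=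
    (intervalIntegrable_const (c := (0 : ℂ))).congr_ae
      ((ae_restrict_iff' measurableSet_uIoc).2 hzero)
  have hval_zero : ∫ x in (0 : ℝ)..((1 - Int.fract b) / a), f x = 0 := by
    rw [← intervalIntegral.integral_congr_ae hzero, intervalIntegral.integral_zero]
  rw [floorRemainder, intervalIntegral.integral_same, sub_zero,
    ← intervalIntegral.integral_add_adjacent_intervals hInt.symm hInt_zero, hval_zero, add_zero,
    intervalIntegral.integral_symm, mul_neg]

lemma tendsto_sawSum_sub_mul_cpow (a b x : ℝ) (s : ℂ) :
    Tendsto (fun N => ((sawSum N (a * x + b) - sawSum N b : ℝ) : ℂ) * (x : ℂ) ^ (-s - 1)) atTop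
      (𝓝 (((saw (a * x + b) - saw b : ℝ) : ℂ) * (x : ℂ) ^ (-s - 1))) :=
  ((Complex.continuous_ofReal.tendsto _).comp
    ((tendsto_sawSum _).sub (tendsto_sawSum _))).mul_const _

lemma ae_saw_sub_mul_cpow_eq {a : ℝ} (ha : a ≠ 0) (b : ℝ) (s : ℂ) :
    ∀ᵐ x : ℝ, 0 < x →
      (1 / π : ℂ) * (((saw (a * x + b) - saw b : ℝ) : ℂ) * (x : ℂ) ^ (-s - 1)
        - (π * (1 / 2 - Int.fract b) - saw b) * (x : ℂ) ^ (-s - 1) + (π * a) * (x : ℂ) ^ (-s))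
      = (⌊a * x + Int.fract b⌋ : ℂ) * (x : ℂ) ^ (-s - 1) := by
  have hπ : (π : ℂ) ≠ 0 := Complex.ofReal_ne_zero.2 pi_ne_zero
  filter_upwards [ae_saw_mul_cpow_eq ha b s] with x hx hpos
  rw [Complex.ofReal_sub, sub_mul, hx hpos]
  field_simp
  ring

section

variable {s : ℂ} {b : ℝ} (hs : s ≠ 0) (h : (s.re < 1 ∧ ∀ m : ℤ, b ≠ m) ∨ s.re < 0)

include h

lemma re_lt_one_of_noninteger_or_neg : s.re < 1 := h.elim And.left fun hneg => hneg.trans one_pos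

lemma saw_eq_or_re_neg : saw b = π * (1 / 2 - Int.fract b) ∨ s.re < 0 := by
  refine h.imp_left fun hb => ?_
  rw [saw, if_neg fun hfract => ?_]
  obtain ⟨m, hm⟩ := Int.fract_eq_zero_iff.1 hfract
  exact hb.2 m hm.symm

lemma exists_sawSum_sub_mul_cpow_bound (a : ℝ) :
    ∃ g : ℝ → ℝ, IntervalIntegrable g volume 0 1 ∧ ∀ (N : ℕ), ∀ x ∈ Ioc (0 : ℝ) 1,
      ‖((sawSum N (a * x + b) - sawSum N b : ℝ) : ℂ) * (x : ℂ) ^ (-s - 1)‖ ≤ g x := by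
  have hnorm (N : ℕ) {x : ℝ} (hx : 0 < x) :
      ‖((sawSum N (a * x + b) - sawSum N b : ℝ) : ℂ) * (x : ℂ) ^ (-s - 1)‖
        = |sawSum N (a * x + b) - sawSum N b| * x ^ (-s.re - 1) := by
    rw [norm_mul, Complex.norm_cpow_eq_rpow_re_of_pos hx, Complex.norm_real, Real.norm_eq_abs,
      Complex.sub_re, Complex.neg_re, Complex.one_re]
  rcases h with ⟨hre, hb⟩ | hre
  · obtain ⟨C, hC⟩ := exists_abs_sawSum_sub_le hb
    refine ⟨fun x => C * |a| * x ^ (-s.re),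
      (intervalIntegral.intervalIntegrable_rpow' (by linarith)).const_mul _, fun N x hx => ?_⟩
    calc _ = |sawSum N (b + a * x) - sawSum N b| * x ^ (-s.re - 1) := by rw [hnorm N hx.1, add_comm]
      _ ≤ C * |a * x| * x ^ (-s.re - 1) :=
        mul_le_mul_of_nonneg_right (hC N (a * x)) (rpow_nonneg hx.1.le _)
      _ = C * |a| * x ^ (-s.re) := by
        rw [abs_mul, abs_of_pos hx.1, rpow_sub_one hx.1.ne']
        field_simp [hx.1.ne']
  · refine ⟨fun x => 16 * x ^ (-s.re - 1),
      (intervalIntegral.intervalIntegrable_rpow' (by linarith)).const_mul _, fun N x hx => ?_⟩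
    rw [hnorm N hx.1]
    refine mul_le_mul_of_nonneg_right ((abs_sub _ _).trans ?_) (rpow_nonneg hx.1.le _)
    linarith [abs_sawSum_le N (a * x + b), abs_sawSum_le N b]

lemma intervalIntegrable_saw_sub_mul_cpow (a : ℝ) :
    IntervalIntegrable (fun x : ℝ => ((saw (a * x + b) - saw b : ℝ) : ℂ) * (x : ℂ) ^ (-s - 1))
      volume 0 1 := by
  obtain ⟨g, hg, hle⟩ := exists_sawSum_sub_mul_cpow_bound h a
  have hmeas : Measurable fun x : ℝ =>
      ((saw (a * x + b) - saw b : ℝ) : ℂ) * (x : ℂ) ^ (-s - 1) :=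
    (Complex.measurable_ofReal.comp ((measurable_saw.comp (by fun_prop)).sub_const _)).mul
      (Complex.measurable_ofReal.pow_const _)
  refine hg.mono_fun' hmeas.aestronglyMeasurable
    ((ae_restrict_iff' measurableSet_uIoc).2 (Eventually.of_forall fun x hx => ?_))
  rw [uIoc_of_le zero_le_one] at hx
  exact le_of_tendsto (tendsto_sawSum_sub_mul_cpow a b x s).norm
    (Eventually.of_forall fun N => hle N x hx)

include hs

lemma tendsto_sum_neg_hyperTerm_integral (a : ℝ) :
    Tendsto (fun N => ∑ k ∈ Finset.range N, -hyperTerm a b 1 (k + 1) s) atTop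
      (𝓝 ((∫ x in (0 : ℝ)..1, ((saw (a * x + b) - saw b : ℝ) : ℂ) * (x : ℂ) ^ (-s - 1))
        - (saw b : ℂ) / s)) := by
  obtain ⟨g, hg, hle⟩ := exists_sawSum_sub_mul_cpow_bound h a
  simp_rw [sum_neg_hyperTerm a b (re_lt_one_of_noninteger_or_neg h) hs]
  refine Tendsto.sub (intervalIntegral.tendsto_integral_filter_of_dominated_convergence g
    (Eventually.of_forall fun N => ?_) (Eventually.of_forall fun N => Eventually.of_forall
      fun x hx => hle N x (uIoc_of_le (zero_le_one (α := ℝ)) ▸ hx)) hg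
    (Eventually.of_forall fun x _ => tendsto_sawSum_sub_mul_cpow a b x s))
    (((Complex.continuous_ofReal.tendsto _).comp (tendsto_sawSum b)).div_const s)
  have hmeas : Measurable (sawSum N) := (continuous_sawSum N).measurable
  exact Measurable.aestronglyMeasurable (by fun_prop)

lemma integral_saw_sub_mul_cpow {a : ℝ} (ha : a ≠ 0) :
    (∫ x in (0 : ℝ)..1, ((saw (a * x + b) - saw b : ℝ) : ℂ) * (x : ℂ) ^ (-s - 1)) - (saw b : ℂ) / s
      = π / s * (a * s / (s - 1) + ((Int.fract b : ℝ) : ℂ) - 1 / 2 - floorRemainder a b 1 s) := by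
  have hre := re_lt_one_of_noninteger_or_neg h
  have hs1 : s - 1 ≠ 0 := sub_ne_zero.2 fun h => by simp [h] at hre
  have hinv : (-s + 1)⁻¹ = -(s - 1)⁻¹ := by rw [← inv_neg, neg_sub, neg_add_eq_sub]
  have hπ : (π : ℂ) ≠ 0 := Complex.ofReal_ne_zero.2 pi_ne_zero
  set κ : ℂ := π * (1 / 2 - Int.fract b) - saw b with hκ
  have hκ_or : κ = 0 ∨ s.re < 0 := by
    refine (saw_eq_or_re_neg h).imp_left fun hb => ?_
    rw [hκ, hb]
    push_cast
    ring
  obtain ⟨hconst, hconst_val⟩ := intervalIntegral_const_mul_cpow_neg_sub_one hκ_or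
  have hsaw := intervalIntegrable_saw_sub_mul_cpow h a
  have hre_neg : -1 < (-s).re := by rw [Complex.neg_re]; linarith
  have hlin := (intervalIntegral.intervalIntegrable_cpow' (a := 0) (b := 1) hre_neg).const_mul
    (π * a : ℂ)
  have hfloor_eq := (ae_saw_sub_mul_cpow_eq ha b s).mono fun x hx (hmem : x ∈ uIoc 0 1) =>
    hx (uIoc_of_le (zero_le_one (α := ℝ)) ▸ hmem).1
  have hfloor : IntervalIntegrable
      (fun x : ℝ => (⌊a * x + Int.fract b⌋ : ℂ) * (x : ℂ) ^ (-s - 1)) volume 0 1 :=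
    (((hsaw.sub hconst).add hlin).const_mul (1 / π : ℂ)).congr_ae
      ((ae_restrict_iff' measurableSet_uIoc).2 hfloor_eq)
  rw [floorRemainder_one ha b hfloor, ← intervalIntegral.integral_congr_ae hfloor_eq,
    intervalIntegral.integral_const_mul, intervalIntegral.integral_add (hsaw.sub hconst) hlin,
    intervalIntegral.integral_sub hsaw hconst, hconst_val, intervalIntegral.integral_const_mul,
    intervalIntegral_zero_one_cpow hre_neg, hinv, hκ]
  field_simp
  ring

lemma tendsto_sum_neg_hyperTerm {a : ℝ} (ha : a ≠ 0) :
    Tendsto (fun N => ∑ k ∈ Finset.range N, -hyperTerm a b 1 (k + 1) s) atTop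
      (𝓝 (π / s * (a * s / (s - 1) + ((Int.fract b : ℝ) : ℂ) - 1 / 2
        - floorRemainder a b 1 s))) :=
  integral_saw_sub_mul_cpow hs h ha ▸ tendsto_sum_neg_hyperTerm_integral hs h a

end

end

theorem theorem1p1 :
    -- `F a b d k` is the `k`-th term, continued to an entire function of `s`
    (∃ F : ℝ → ℝ → ℝ → ℕ → ℂ → ℂ,
      (∀ a b d : ℝ, a ≠ 0 → 0 < d →
        (∀ k : ℕ, 1 ≤ k → Differentiable ℂ (F a b d k) ∧
          ∀ s : ℂ, (∀ n : ℕ, s ≠ n) →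
            F a b d k s = hyperTerm a b d k s + gammaTerm a b k s) ∧
        (∀ s : ℂ, Summable fun k : ℕ => ‖F a b d (k + 1) s‖) ∧
        Differentiable ℂ (fun s : ℂ => ∑' k : ℕ, F a b d (k + 1) s) ∧
        (∀ s : ℂ, 1 < s.re → zetaSide a b d s = ∑' k : ℕ, F a b d (k + 1) s)) ∧
      (∀ c C ε : ℝ, 0 < c → 0 < ε →
        AbsUnifConvOn
          (fun k (p : ℝ × ℝ × ℝ × ℂ) =>
            (p.2.2.1 : ℂ) ^ p.2.2.2 * F p.1 p.2.1 p.2.2.1 (k + 1) p.2.2.2)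
          (paramRegion c C ε) ∧
        ∀ B : ℝ, AbsUnifConvOn
          (fun k (p : ℝ × ℝ × ℝ × ℂ) => F p.1 p.2.1 p.2.2.1 (k + 1) p.2.2.2)
          (paramRegion c C ε ∩ {p | 1 ≤ p.2.2.1 ∨ p.2.2.2.re ≤ B}))) ∧
    (∀ (a b : ℝ) (s : ℂ), a ≠ 0 → s ≠ 0 →
      ((s.re < 1 ∧ ∀ m : ℤ, b ≠ m) ∨ (s.re < 0 ∧ ∃ m : ℤ, b = m)) →
      Filter.Tendsto
        (fun N : ℕ => ∑ k ∈ Finset.Icc 1 N,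
          (2 * Real.pi * a * (Real.cos (2 * Real.pi * b * k) : ℂ) / (1 - s) *
              hyp1F2 ((1 - s) / 2) (3 / 2) (1 + (1 - s) / 2)
                (-((Real.pi ^ 2 * a ^ 2 * (k : ℝ) ^ 2 : ℝ) : ℂ))
            - (Real.sin (2 * Real.pi * b * k) : ℂ) / (s * k) *
              hyp1F2 (-s / 2) (1 / 2) (1 - s / 2)
                (-((Real.pi ^ 2 * a ^ 2 * (k : ℝ) ^ 2 : ℝ) : ℂ))))
        Filter.atTop
        (nhds (Real.pi / s * (a * s / (s - 1) + ((Int.fract b : ℝ) : ℂ) - 1 / 2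
          - floorRemainder a b 1 s)))) := by
  refine ⟨⟨fourierTail, fun a b d ha hd => ⟨fun k hk => ⟨differentiable_fourierTail ha b hd hk,
      fun s hs => fourierTail_eq_hyperTerm_add_gammaTerm ha b hd hk hs⟩,
      summable_norm_fourierTail ha b hd, differentiable_tsum_fourierTail ha b hd,
      fun s hs => zetaSide_eq_tsum ha b hd hs⟩,
    fun c C ε hc hε => ⟨absUnifConvOn_scaled_fourierTail hc C ε,
      fun B => absUnifConvOn_fourierTail hc hε B⟩⟩, fun a b s ha hs h => ?_⟩
  convert tendsto_sum_neg_hyperTerm hs (h.imp_right And.left) ha using 2 with N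
  rw [Finset.range_eq_Ico, Finset.sum_Ico_add' (fun k => -hyperTerm a b 1 k s) 0 N 1]
  refine Finset.sum_congr (by ext; simp) fun k _ => ?_
  simp only [hyperTerm, Complex.ofReal_one, Complex.one_cpow, one_mul, mul_one, one_pow]
  ring
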